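/- Let $q$ be a prime power and let $\mathbb{F}_{q^2}$ be the field with $q^2$ elements. A linear $[n,k]_{q^2}$ code is a $k$-dimensional subspace $C$ of $\mathbb{F}_{q^2}^n$; its Hermitian dual is $C^{\perp_{\rm H}}=\{\mathbf y\in\mathbb{F}_{q^2}^n : \sum_{i=1}^n x_iy_i^q=0 \text{ for all } \mathbf x\in C\}$ and its Hermitian hull is $C\cap C^{\perp_{\rm H}}$. For $\ell\ge 0$ let ${\rm HHull}[n,k]^{\ell}_{q^2}$ be the set of all linear $[n,k]_{q^2}$ codes whose Hermitian hull has dimension $\ell$ (for $\ell=0$ these are the Hermitian LCD codes). For real $x>1$ put $$\begin{bmatrix} n\\ k\end{bmatrix}_x=\prod_{i=0}^{k-1}\frac{x^n-x^i}{x^k-x^i},\qquad g_{x,n}=\prod_{i=1}^n\Bigl(1-\frac1{x^i}\Bigr),\qquad g_{x,\infty}=\lim_{n\to\infty}g_{x,n},\qquad h_{x,\ell}=\prod_{i=1}^{\ell}(x^i-1).$$ **Theorem 3.8.** For every fixed integer $\ell\ge 0$, as $k\to\infty$ and $n-k\to\infty$ (jointly and independently of each other), $$\lim_{\substack{k\to\infty\\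 n-k\to\infty}}\frac{\bigl|{\rm HHull}[n,k]^{\ell}_{q^2}\bigr|}{\begin{bmatrix} n\\ k\end{bmatrix}_{q^2}}=\frac{q^{\ell}\, g_{q,\infty}\, g_{q^4,\infty}}{h_{q^2,\ell}\, g_{q^2,\infty}^2}.$$ In particular, for $\ell=0$, $$\lim_{\substack{k\to\infty\\ n-k\to\infty}}\frac{\bigl|{\rm HHull}[n,k]^{0}_{q^2}\bigr|}{\begin{bmatrix} n\\ k\end{bmatrix}_{q^2}}=\frac{g_{q,\infty}\, g_{q^4,\infty}}{g_{q^2,\infty}^2}.$$ -/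

import Mathlib

open Filter Topology

/-! ### The Hermitian inner product on `F ^ n`, where `F` is a field with `q ^ 2` elements -/

/-- `⟨x, y⟩_H = ∑ i, x i * (y i) ^ q`. -/
def hermInner {F : Type*} [Field F] (q : ℕ) {n : ℕ} (x y : Fin n → F) : F :=
  ∑ i, x i * y i ^ q

/-- In a field with `q ^ 2` elements, the conjugation `a ↦ a ^ q` is additive. -/
theorem add_pow_of_card_eq_sq {F : Type*} [Field F] [Fintype F] {q : ℕ}
    (hF : Fintype.card F = q ^ 2) (a b : F) : (a + b) ^ q = a ^ q + b ^ q := by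
  obtain ⟨p, hp⟩ := CharP.exists F
  obtain ⟨m, hpp, hm⟩ := FiniteField.card F p
  have : Fact p.Prime := ⟨hpp⟩
  have h : q ∣ p ^ (m : ℕ) := by
    rw [← hm, hF]
    exact dvd_pow_self q two_ne_zero
  obtain ⟨r, -, rfl⟩ := (Nat.dvd_prime_pow hpp).1 h
  exact add_pow_char_pow a b p r

/-- The cardinality being `q ^ 2`, the number `q` is positive. -/
theorem ne_zero_of_card_eq_sq {F : Type*} [Field F] [Fintype F] {q : ℕ}
    (hF : Fintype.card F = q ^ 2) : q ≠ 0 := by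
  rintro rfl
  simp at hF

/-- The Hermitian dual code `{y | ⟨x, y⟩_H = 0 for all x ∈ C}` of a linear code `C ⊆ F ^ n`. -/
def hermDual {F : Type*} [Field F] [Fintype F] {q : ℕ} (hF : Fintype.card F = q ^ 2) {n : ℕ}
    (C : Submodule F (Fin n → F)) : Submodule F (Fin n → F) where
  carrier := {y | ∀ x ∈ C, hermInner q x y = 0}
  zero_mem' := by
    intro x _
    simp [hermInner, ne_zero_of_card_eq_sq hF]
  add_mem' := by
    intro y z hy hz x hx
    have h1 := hy x hx
    have h2 := hz x hx
    simp only [hermInner] at h1 h2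
    simp [hermInner, add_pow_of_card_eq_sq hF, mul_add, Finset.sum_add_distrib, h1, h2]
  smul_mem' := by
    intro c y hy x hx
    have h1 := hy x hx
    simp only [hermInner] at h1
    have h2 : ∀ i, x i * (c * y i) ^ q = c ^ q * (x i * y i ^ q) := by
      intro i
      rw [mul_pow]
      ring
    simp [hermInner, h2, ← Finset.mul_sum, h1]

/-- The Hermitian hull `C ∩ C^{⊥_H}`. -/
def hermHull {F : Type*} [Field F] [Fintype F] {q : ℕ} (hF : Fintype.card F = q ^ 2) {n : ℕ}
    (C : Submodule F (Fin n → F)) : Submodule F (Fin n → F) :=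
  C ⊓ hermDual hF C

/-- `HHull[n, k]^ℓ`: the set of all `k`-dimensional linear codes of length `n` over the field `F`
with `q ^ 2` elements whose Hermitian hull has dimension `ℓ`. -/
def HHull {F : Type*} [Field F] [Fintype F] {q : ℕ} (hF : Fintype.card F = q ^ 2)
    (n k l : ℕ) : Set (Submodule F (Fin n → F)) :=
  {C | Module.finrank F C = k ∧ Module.finrank F (hermHull hF C) = l}

/-! ### Gaussian binomial coefficients and the constants `g` and `h` -/

/-- The Gaussian binomial coefficient
`(q^n - 1)(q^n - q)⋯(q^n - q^(k-1)) / ((q^k - 1)(q^k - q)⋯(q^k - q^(k-1)))`;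
it is `1` for `k = 0`. -/
noncomputable def gaussBinom (q : ℝ) (n k : ℕ) : ℝ :=
  (∏ i ∈ Finset.range k, (q ^ n - q ^ i)) / ∏ i ∈ Finset.range k, (q ^ k - q ^ i)

/-- `g_{q,n} = ∏_{i=1}^n (1 - 1 / q^i)`. -/
noncomputable def gSeq (q : ℝ) (n : ℕ) : ℝ :=
  ∏ i ∈ Finset.Icc 1 n, (1 - 1 / q ^ i)

/-- `g_{q,∞} = lim_{n → ∞} g_{q,n}`, for `q > 1`. -/
noncomputable def gInf (q : ℝ) : ℝ :=
  limUnder atTop (gSeq q)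

/-- `h_{q,ℓ} = ∏_{i=1}^ℓ (q^i - 1)`. -/
noncomputable def hProd (q : ℝ) (l : ℕ) : ℝ :=
  ∏ i ∈ Finset.Icc 1 l, (q ^ i - 1)

/-- The limit defining `g_{q,∞}` exists and is positive. -/
theorem gSeq_tendsto_and_pos {q : ℝ} (hq : 1 < q) :
    Tendsto (gSeq q) atTop (𝓝 (gInf q)) ∧ 0 < gInf q := by
  have hq0 : 0 < q := by linarith
  have hs : Summable (fun i : ℕ => -(1 / q ^ (i + 1))) := by
    have h := (summable_nat_add_iff 1).2
      (summable_geometric_of_lt_one (inv_nonneg.2 hq0.le) (inv_lt_one_of_one_lt₀ hq))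
    refine h.neg.congr fun i => ?_
    simp
  have hpos : ∀ i : ℕ, 0 < 1 + -(1 / q ^ (i + 1)) := by
    intro i
    have h1 : 1 < q ^ (i + 1) := one_lt_pow₀ hq (Nat.succ_ne_zero i)
    have h2 : 1 / q ^ (i + 1) < 1 := by
      rw [div_lt_one (by linarith)]
      exact h1
    linarith
  have hprod := Real.hasProd_of_hasSum_log hpos (Real.summable_log_one_add_of_summable hs).hasSum
  have ht := hprod.tendsto_prod_nat
  have he : (fun n => ∏ i ∈ Finset.range n, (1 + -(1 / q ^ (i + 1)))) = gSeq q := by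
    funext n
    rw [gSeq]
    induction n with
    | zero => simp
    | succ n ih =>
      rw [Finset.prod_range_succ, ih, Finset.prod_Icc_succ_top (by omega), sub_eq_add_neg]
  rw [he] at ht
  have hl : gInf q = _ := ht.limUnder_eq
  rw [hl]
  exact ⟨ht, Real.exp_pos _⟩

/-! ### The limit `k → ∞`, `n - k → ∞` -/

/-- The filter on pairs `(n, k)` along which `k → ∞` and `n - k → ∞` (as integers, jointly and
independently of each other). -/
noncomputable def codeLimit : Filter (ℕ × ℕ) :=
  comap (fun p : ℕ × ℕ => p.2) atTop ⊓ comap (fun p : ℕ × ℕ => (p.1 : ℤ) - (p.2 : ℤ)) atTop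

/-! ### Norm and trace fibres of the extension `𝔽_{q²} / 𝔽_q` -/

/-! The argument is the method of moments for the hull dimension of a random code. A linearly
independent `m`-tuple lies in the hull of `C` exactly when its span `W` satisfies `W ≤ C ≤ W^⊥`,
which forces `W` to be totally isotropic. Counting pairs (code, tuple in its hull) in two ways
therefore gives the Gaussian binomial moments of the hull dimension exactly: the number of isotropic
tuples times the number of codes between `W` and its dual (`sum_ncard_HHull_mul_prod`). Isotropic
tuples are counted by extending one vector at a time (`card_isotropicTuple`), which rests on the
fibres of the norm and the trace of the quadratic extension.

Put `x = q^2`. After division by the number of codes, the `m`-th moment is `q^m / h_{x,m}` times a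
factor `momentRatio` that is bounded uniformly in all parameters and tends to 1 for fixed `m`.
Inverting the `x`-binomial transform (`eq_sum_alternating_binomial_transform`) writes the proportion
of codes with hull dimension `l` as `q^l / h_{x,l}` times `∑ (-1/q)^j / g_{x,j}`, each term weighted
by such a factor. The series converges geometrically, so dominated convergence removes the factors.
Euler's identity evaluates what remains as `∏ (1 + q^{-(2i+1)})⁻¹ = g_q g_{q^4} / g_{q^2}^2`
(`tsum_neg_inv_pow_div_gSeq`). -/

theorem Finset.card_fiber_eq_of_card_eq_mul {α β : Type*} [DecidableEq β] {s : Finset α}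
    {t : Finset β} {f : α → β} {a b : ℕ} (hf : ∀ x ∈ s, f x ∈ t)
    (hfib : ∀ y ∈ t, (s.filter (f · = y)).card ≤ a) (ht : t.card ≤ b) (hs : s.card = b * a) :
    ∀ y ∈ t, (s.filter (f · = y)).card = a := by
  intro y hy
  by_contra hne
  -- A single deficient fibre would make the total strictly less than `t.card * a ≤ b * a = s.card`.
  have hlt : ∑ z ∈ t, (s.filter (f · = z)).card < ∑ _z ∈ t, a :=
    Finset.sum_lt_sum hfib ⟨y, hy, lt_of_le_of_ne (hfib y hy) hne⟩
  rw [← Finset.card_eq_sum_card_fiberwise hf, Finset.sum_const, smul_eq_mul, hs] at hlt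
  exact absurd (Nat.mul_le_mul_right a ht) (not_le.2 hlt)

section Field

variable {F : Type*} [Field F] [Fintype F] {q : ℕ}

theorem two_le_of_card_eq_sq (hF : Fintype.card F = q ^ 2) : 2 ≤ q := by
  have h1 : 1 < q ^ 2 := hF ▸ Fintype.one_lt_card
  by_contra h
  have : q ≤ 1 := by omega
  have := Nat.pow_le_pow_left this 2
  omega

theorem pow_pow_of_card_eq_sq (hF : Fintype.card F = q ^ 2) (a : F) : (a ^ q) ^ q = a := by
  rw [← pow_mul, ← sq, ← hF, FiniteField.pow_card]

/-- The norm sends `q^2 - 1 = (q - 1)(q + 1)` nonzero elements into at most `q - 1` nonzero fixed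
points of conjugation, and root counting bounds each fibre by `q + 1`; hence every bound is
attained. -/
theorem card_filter_mul_pow_eq [DecidableEq F] (hF : Fintype.card F = q ^ 2) {c : F} (hc : c ≠ 0)
    (hcq : c ^ q = c) : (Finset.univ.filter fun t : F => t * t ^ q = c).card = q + 1 := by
  have hq := two_le_of_card_eq_sq hF
  have key := Finset.card_fiber_eq_of_card_eq_mul (s := Finset.univ.filter fun t : F => t ≠ 0)
    (t := Finset.univ.filter fun c : F => c ≠ 0 ∧ c ^ q = c) (f := fun t : F => t * t ^ q)
    (a := q + 1) (b := q - 1) ?_ ?_ ?_ ?_ c (by simp [hc, hcq])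
  · rw [← key, Finset.filter_filter]
    congr 1
    ext t
    simp only [Finset.mem_filter, Finset.mem_univ, true_and]
    refine ⟨fun h => ⟨?_, h⟩, fun h => h.2⟩
    rintro rfl
    exact hc (by simpa using h.symm)
  · intro t ht
    simp only [Finset.mem_filter, Finset.mem_univ, true_and] at ht ⊢
    refine ⟨mul_ne_zero ht (pow_ne_zero _ ht), ?_⟩
    rw [mul_pow, pow_pow_of_card_eq_sq hF, mul_comm]
  · intro y _
    refine le_trans (Finset.card_le_card (t := (Polynomial.nthRoots (q + 1) y).toFinset) ?_)
      ((Multiset.toFinset_card_le _).trans (Polynomial.card_nthRoots _ _))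
    intro t ht
    simp only [Finset.mem_filter, Finset.mem_univ, true_and] at ht
    rw [Multiset.mem_toFinset, Polynomial.mem_nthRoots (by omega), pow_succ', ht.2]
  · refine le_trans (Finset.card_le_card (t := (Polynomial.nthRoots (q - 1) (1 : F)).toFinset) ?_)
      ((Multiset.toFinset_card_le _).trans (Polynomial.card_nthRoots _ _))
    intro t ht
    simp only [Finset.mem_filter, Finset.mem_univ, true_and] at ht
    rw [Multiset.mem_toFinset, Polynomial.mem_nthRoots (by omega)]
    apply mul_left_cancel₀ ht.1
    rw [← pow_succ', Nat.sub_add_cancel (by omega), ht.2, mul_one]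
  · rw [Finset.filter_ne', Finset.card_erase_of_mem (Finset.mem_univ _), Finset.card_univ, hF,
      mul_comm, ← Nat.sq_sub_sq, one_pow]

theorem card_filter_pow_eq_self_le [DecidableEq F] (hq : 2 ≤ q) :
    (Finset.univ.filter fun c : F => c ^ q = c).card ≤ q := by
  have hne : (Polynomial.X ^ q - Polynomial.X : Polynomial F) ≠ 0 :=
    FiniteField.X_pow_card_sub_X_ne_zero F (by omega)
  refine le_trans (Finset.card_le_card
    (t := (Polynomial.X ^ q - Polynomial.X : Polynomial F).roots.toFinset) ?_)
    ((Multiset.toFinset_card_le _).trans ((Polynomial.card_roots' _).trans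
      (FiniteField.X_pow_card_sub_X_natDegree_eq F (by omega)).le))
  intro t ht
  simp only [Finset.mem_filter, Finset.mem_univ, true_and] at ht
  simp [Polynomial.mem_roots hne, ht]

/-- Same squeeze for the trace: `q^2` elements, at most `q` fixed points, and fibres of size at most
the degree `q`. -/
theorem card_filter_add_pow_eq [DecidableEq F] (hF : Fintype.card F = q ^ 2) {c : F}
    (hcq : c ^ q = c) : (Finset.univ.filter fun t : F => t + t ^ q = c).card = q := by
  have hq := two_le_of_card_eq_sq hF
  refine Finset.card_fiber_eq_of_card_eq_mul (s := Finset.univ)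
    (t := Finset.univ.filter fun c : F => c ^ q = c) (f := fun t : F => t + t ^ q)
    (a := q) (b := q) ?_ ?_ (card_filter_pow_eq_self_le hq) ?_ c (by simp [hcq])
  · intro t _
    simp only [Finset.mem_filter, Finset.mem_univ, true_and]
    rw [add_pow_of_card_eq_sq hF, pow_pow_of_card_eq_sq hF, add_comm]
  · intro y _
    have hdeg : (Polynomial.X ^ q + Polynomial.X - Polynomial.C y : Polynomial F).natDegree = q := by
      have h1 : (Polynomial.X - Polynomial.C y : Polynomial F).natDegree < q := by
        rw [Polynomial.natDegree_X_sub_C]; omega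
      rw [add_sub_assoc, Polynomial.natDegree_add_eq_left_of_natDegree_lt] <;>
        rw [Polynomial.natDegree_X_pow]
      exact h1
    have hne : (Polynomial.X ^ q + Polynomial.X - Polynomial.C y : Polynomial F) ≠ 0 := by
      intro h
      rw [h, Polynomial.natDegree_zero] at hdeg
      omega
    refine le_trans (Finset.card_le_card
      (t := (Polynomial.X ^ q + Polynomial.X - Polynomial.C y : Polynomial F).roots.toFinset) ?_)
      ((Multiset.toFinset_card_le _).trans ((Polynomial.card_roots' _).trans hdeg.le))
    intro t ht
    simp only [Finset.mem_filter, Finset.mem_univ, true_and] at ht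
    rw [Multiset.mem_toFinset, Polynomial.mem_roots hne]
    simp [Polynomial.IsRoot, ← ht, add_comm]
  · rw [Finset.card_univ, hF, sq]

theorem card_filter_pow_eq_self [DecidableEq F] (hF : Fintype.card F = q ^ 2) :
    (Finset.univ.filter fun c : F => c ^ q = c).card = q := by
  have hq := two_le_of_card_eq_sq hF
  have h : (Finset.univ : Finset F).card =
      ∑ c ∈ Finset.univ.filter (fun c : F => c ^ q = c),
        (Finset.univ.filter fun t : F => t + t ^ q = c).card := by
    refine Finset.card_eq_sum_card_fiberwise (f := fun t : F => t + t ^ q) ?_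
    intro t _
    simp only [Finset.coe_filter, Finset.mem_univ, true_and, Set.mem_ofPred_eq]
    rw [add_pow_of_card_eq_sq hF, pow_pow_of_card_eq_sq hF, add_comm]
  rw [Finset.sum_congr rfl fun c hc => card_filter_add_pow_eq hF (Finset.mem_filter.1 hc).2,
    Finset.sum_const, smul_eq_mul, Finset.card_univ, hF, sq] at h
  exact (Nat.eq_of_mul_eq_mul_right (by omega) h).symm

/-! ### The Hermitian form and the dual -/

variable {n : ℕ}

omit [Fintype F] in
theorem hermInner_add_left (x y z : Fin n → F) :
    hermInner q (x + y) z = hermInner q x z + hermInner q y z := by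
  simp [hermInner, add_mul, Finset.sum_add_distrib]

omit [Fintype F] in
theorem hermInner_smul_left (a : F) (x z : Fin n → F) :
    hermInner q (a • x) z = a * hermInner q x z := by
  simp [hermInner, Finset.mul_sum, mul_assoc]

theorem hermInner_add_right (hF : Fintype.card F = q ^ 2) (x y z : Fin n → F) :
    hermInner q x (y + z) = hermInner q x y + hermInner q x z := by
  simp [hermInner, add_pow_of_card_eq_sq hF, mul_add, Finset.sum_add_distrib]

/-- The conjugation `a ↦ a ^ q` as a ring homomorphism. -/
def conjHom (hF : Fintype.card F = q ^ 2) : F →+* F where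
  toFun a := a ^ q
  map_one' := one_pow q
  map_mul' a b := mul_pow a b q
  map_zero' := zero_pow (ne_zero_of_card_eq_sq hF)
  map_add' := add_pow_of_card_eq_sq hF

theorem hermInner_conj (hF : Fintype.card F = q ^ 2) (x y : Fin n → F) :
    hermInner q y x ^ q = hermInner q x y := by
  change conjHom hF (hermInner q y x) = _
  simp only [hermInner, map_sum, map_mul, map_pow]
  refine Finset.sum_congr rfl fun i _ => ?_
  change y i ^ q * (x i ^ q) ^ q = _
  rw [pow_pow_of_card_eq_sq hF, mul_comm]

/-- Turns isotropy of a translate by an isotropic vector into a trace equation for `⟨w, x⟩`, whose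
solutions can be counted. -/
theorem hermInner_add_self_eq_zero_iff (hF : Fintype.card F = q ^ 2) {x w : Fin n → F}
    (hw : hermInner q w w = 0) : hermInner q (x + w) (x + w) = 0 ↔
      hermInner q w x + hermInner q w x ^ q = -hermInner q x x := by
  rw [eq_neg_iff_add_eq_zero, hermInner_add_left, hermInner_add_right hF,
    hermInner_add_right hF, hw, hermInner_conj hF x w]
  ring_nf

theorem hermInner_eq_zero_comm (hF : Fintype.card F = q ^ 2) {x y : Fin n → F} :
    hermInner q x y = 0 ↔ hermInner q y x = 0 := by
  rw [← hermInner_conj hF x y, pow_eq_zero_iff (ne_zero_of_card_eq_sq hF)]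

theorem mem_hermDual (hF : Fintype.card F = q ^ 2) {C : Submodule F (Fin n → F)}
    {y : Fin n → F} : y ∈ hermDual hF C ↔ ∀ x ∈ C, hermInner q x y = 0 := Iff.rfl

theorem le_hermDual_comm (hF : Fintype.card F = q ^ 2) {C D : Submodule F (Fin n → F)} :
    C ≤ hermDual hF D ↔ D ≤ hermDual hF C :=
  ⟨fun h x hx _ hy => (hermInner_eq_zero_comm hF).1 (h hy x hx),
    fun h x hx _ hy => (hermInner_eq_zero_comm hF).1 (h hy x hx)⟩

/-- `x ↦ ⟨x, y⟩_H` as a linear form. -/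
def hermForm (q : ℕ) (y : Fin n → F) : Module.Dual F (Fin n → F) where
  toFun x := hermInner q x y
  map_add' x x' := hermInner_add_left x x' y
  map_smul' a x := hermInner_smul_left a x y

theorem hermForm_bijective (hF : Fintype.card F = q ^ 2) :
    Function.Bijective (hermForm q : (Fin n → F) → Module.Dual F (Fin n → F)) := by
  have hs (i : Fin n) (y : Fin n → F) : hermForm q y (Pi.single i 1) = y i ^ q := by
    change hermInner q (Pi.single i 1) y = _
    simp [hermInner, Pi.single_apply]
  constructor
  · intro y z h
    ext i
    have := congrArg (fun φ => φ (Pi.single i 1)) h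
    simp only [hs] at this
    rw [← pow_pow_of_card_eq_sq hF (y i), this, pow_pow_of_card_eq_sq hF]
  · intro φ
    refine ⟨fun i => φ (Pi.single i 1) ^ q, ?_⟩
    refine (Pi.basisFun F (Fin n)).ext fun i => ?_
    rw [Pi.basisFun_apply, hs, pow_pow_of_card_eq_sq hF]

theorem card_submodule {V : Type*} [AddCommGroup V] [Module F V] [Finite V]
    (hF : Fintype.card F = q ^ 2) (W : Submodule F V) :
    Nat.card W = (q ^ 2) ^ Module.finrank F W := by
  rw [Module.natCard_eq_pow_finrank (K := F), Nat.card_eq_fintype_card, hF]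

theorem finrank_hermDual (hF : Fintype.card F = q ^ 2) (C : Submodule F (Fin n → F)) :
    Module.finrank F C + Module.finrank F (hermDual hF C) = n := by
  have hq := two_le_of_card_eq_sq hF
  -- The correspondence is only conjugate-linear, so dimensions are compared through cardinalities.
  have e : hermDual hF C ≃ C.dualAnnihilator :=
    (Equiv.ofBijective _ (hermForm_bijective hF)).subtypeEquiv fun _ => by
      simp only [mem_hermDual, Submodule.mem_dualAnnihilator]
      rfl
  have : Finite (Module.Dual F (Fin n → F)) := Module.finite_of_finite F
  have h := Nat.card_congr e
  rw [card_submodule hF, card_submodule hF] at h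
  rw [Nat.pow_right_injective (show 2 ≤ q ^ 2 by nlinarith) h,
    Subspace.finrank_add_finrank_dualAnnihilator_eq, Module.finrank_fin_fun]

theorem exists_hermInner_ne_zero (hF : Fintype.card F = q ^ 2) {C : Submodule F (Fin n → F)}
    {x : Fin n → F} (hx : x ∉ hermDual hF C) : ∃ w : C, hermInner q w.1 x ≠ 0 := by
  rw [mem_hermDual] at hx
  push Not at hx
  obtain ⟨w, hw, h⟩ := hx
  exact ⟨⟨w, hw⟩, h⟩

/-! ### Counting isotropic vectors -/

/-- The number of isotropic vectors of `F ^ n`. -/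
noncomputable def isoCard (F : Type*) [Field F] (q n : ℕ) : ℕ :=
  Nat.card {x : Fin n → F // hermInner q x x = 0}

/-- Split off the first coordinate `t`: its norm must equal `-⟨y, y⟩`, which has one solution if `y`
is isotropic and `q + 1` otherwise. -/
theorem isoCard_succ (hF : Fintype.card F = q ^ 2) (n : ℕ) :
    isoCard F q (n + 1) + q * isoCard F q n = (q + 1) * (q ^ 2) ^ n := by
  classical
  have e : {x : Fin (n + 1) → F // hermInner q x x = 0} ≃
      Σ y : Fin n → F, {t : F // t * t ^ q = -hermInner q y y} :=
    ((Fin.consEquiv fun _ : Fin (n + 1) => F).symm.subtypeEquiv fun x => by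
      change _ ↔ x 0 * x 0 ^ q = -hermInner q (Fin.tail x) (Fin.tail x)
      rw [eq_neg_iff_add_eq_zero, hermInner, Fin.sum_univ_succ]
      rfl).trans <|
    ((Equiv.prodComm _ _).subtypeEquiv
      (q := fun z : (Fin n → F) × F => z.2 * z.2 ^ q = -hermInner q z.1 z.1)
      fun x => Iff.rfl).trans
    (Equiv.subtypeProdEquivSigmaSubtype
      fun (y : Fin n → F) (t : F) => t * t ^ q = -hermInner q y y)
  rw [isoCard, Nat.card_congr e, Nat.card_sigma, isoCard, Nat.card_eq_fintype_card,
    Fintype.card_subtype, Finset.card_filter, Finset.mul_sum, ← Finset.sum_add_distrib]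
  have hq0 := ne_zero_of_card_eq_sq hF
  rw [Finset.sum_congr rfl (g := fun _ => q + 1)]
  · simp [hF, mul_comm]
  · intro y _
    rw [Nat.card_eq_fintype_card, Fintype.card_subtype]
    split_ifs with h
    · rw [h]
      have : (Finset.univ.filter fun t : F => t * t ^ q = -0) = {0} := by
        ext t
        simp [hq0]
      rw [this, Finset.card_singleton]
      ring
    · rw [card_filter_mul_pow_eq hF (neg_ne_zero.2 h), mul_zero, add_zero]
      have := map_neg (conjHom hF) (hermInner q y y)
      change (-hermInner q y y) ^ q = -(hermInner q y y) ^ q at this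
      rw [this, hermInner_conj hF]

theorem mul_isoCard (hF : Fintype.card F = q ^ 2) (n : ℕ) :
    (q : ℝ) * isoCard F q n = (q : ℝ) ^ (2 * n) + (-1) ^ n * ((q : ℝ) ^ (n + 1) - (q : ℝ) ^ n) := by
  induction n with
  | zero => simp [isoCard, hermInner]
  | succ n ih =>
    have h : ((isoCard F q (n + 1) : ℝ) + q * isoCard F q n = (q + 1) * ((q : ℝ) ^ 2) ^ n) := by
      exact_mod_cast isoCard_succ hF n
    rw [eq_sub_of_add_eq h, ih]
    ring

/-- The trace of `⟨w, x⟩` is an additive map from `W` onto the `q` fixed points of conjugation, as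
`⟨·, x⟩` is nonzero on `W`; its fibres have equal size. -/
theorem mul_card_hermInner_add_pow_eq (hF : Fintype.card F = q ^ 2)
    {W : Submodule F (Fin n → F)} {x : Fin n → F} (hx : x ∉ hermDual hF W) {c : F}
    (hc : c ^ q = c) :
    q * Nat.card {w : W // hermInner q w.1 x + hermInner q w.1 x ^ q = c} =
      (q ^ 2) ^ Module.finrank F W := by
  classical
  let φ : W →+ F :=
    { toFun := fun w => hermInner q w.1 x + hermInner q w.1 x ^ q
      map_zero' := by simp [hermInner, ne_zero_of_card_eq_sq hF]
      map_add' := fun v w => by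
        rw [Submodule.coe_add, hermInner_add_left, add_pow_of_card_eq_sq hF]
        ring }
  obtain ⟨w, hw⟩ := exists_hermInner_ne_zero hF hx
  have hrange : ∀ c : F, c ^ q = c → c ∈ Set.range φ := by
    intro c hc
    obtain ⟨t, ht⟩ : (Finset.univ.filter fun t : F => t + t ^ q = c).Nonempty := by
      rw [← Finset.card_pos, card_filter_add_pow_eq hF hc]
      have := two_le_of_card_eq_sq hF
      omega
    refine ⟨(t / hermInner q w.1 x) • w, ?_⟩
    change hermInner q ((t / hermInner q w.1 x) • w.1) x +
      hermInner q ((t / hermInner q w.1 x) • w.1) x ^ q = c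
    rw [hermInner_smul_left, div_mul_cancel₀ _ hw]
    exact (Finset.mem_filter.1 ht).2
  have hsum : Fintype.card W = ∑ c ∈ Finset.univ.filter (fun c : F => c ^ q = c),
      (Finset.univ.filter fun w : W => φ w = c).card := by
    refine Finset.card_eq_sum_card_fiberwise (f := φ) ?_
    intro w _
    simp only [Finset.coe_filter, Finset.mem_univ, true_and, Set.mem_ofPred_eq]
    change (hermInner q w.1 x + hermInner q w.1 x ^ q) ^ q = _ + _
    rw [add_pow_of_card_eq_sq hF, pow_pow_of_card_eq_sq hF, add_comm]
  rw [Finset.sum_congr rfl fun d hd => AddMonoidHom.card_fiber_eq_of_mem_range φ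
    (hrange d (Finset.mem_filter.1 hd).2) (hrange c hc), Finset.sum_const,
    card_filter_pow_eq_self hF, smul_eq_mul, ← Nat.card_eq_fintype_card, card_submodule hF] at hsum
  rw [hsum, Nat.card_eq_fintype_card, Fintype.card_subtype]
  rfl

/-- The number of isotropic vectors in the dual of a totally isotropic subspace. -/
theorem mul_card_isotropic_hermDual (hF : Fintype.card F = q ^ 2)
    {W : Submodule F (Fin n → F)} (hW : W ≤ hermDual hF W) :
    q * Nat.card {x : Fin n → F // x ∈ hermDual hF W ∧ hermInner q x x = 0} + (q ^ 2) ^ n =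
      q * isoCard F q n + (q ^ 2) ^ (n - Module.finrank F W) := by
  classical
  set m := Module.finrank F W
  have hsplit : isoCard F q n =
      Nat.card {x : Fin n → F // x ∈ hermDual hF W ∧ hermInner q x x = 0} +
      Nat.card {x : Fin n → F // x ∉ hermDual hF W ∧ hermInner q x x = 0} := by
    simp only [isoCard, Nat.card_eq_fintype_card, Fintype.card_subtype]
    rw [← Finset.card_filter_add_card_filter_not
        (s := Finset.univ.filter fun x : Fin n → F => hermInner q x x = 0)
        (fun x => x ∈ hermDual hF W),
      Finset.filter_filter, Finset.filter_filter]
    simp only [and_comm]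
  have hcompl : Nat.card {x : Fin n → F // x ∉ hermDual hF W} + (q ^ 2) ^ (n - m) =
      (q ^ 2) ^ n := by
    have h1 : Nat.card {x : Fin n → F // x ∈ hermDual hF W} = (q ^ 2) ^ (n - m) := by
      have := finrank_hermDual hF W
      rw [show n - m = Module.finrank F (hermDual hF W) by omega]
      exact card_submodule hF _
    rw [← h1, Nat.card_eq_fintype_card, Nat.card_eq_fintype_card, Fintype.card_subtype,
      Fintype.card_subtype, add_comm, Finset.card_filter_add_card_filter_not]
    simp [hF]
  -- The shear `(x, w) ↦ (x + w, w)` preserves the complement of `W^⊥` because `W ≤ W^⊥`. For each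
  -- such `x` exactly `|W| / q` translates are isotropic, so the isotropic vectors make up exactly
  -- `1 / q` of the complement.
  have e : (Σ x : {x : Fin n → F // x ∉ hermDual hF W},
      {w : W // hermInner q w.1 x.1 + hermInner q w.1 x.1 ^ q = -hermInner q x.1 x.1}) ≃
      {x : Fin n → F // x ∉ hermDual hF W ∧ hermInner q x x = 0} × W :=
    { toFun := fun z => (⟨z.1.1 + z.2.1.1, by
          have hw : z.2.1.1 ∈ hermDual hF W := hW z.2.1.2
          refine ⟨fun h => z.1.2 (by simpa using sub_mem h hw), ?_⟩
          exact (hermInner_add_self_eq_zero_iff hF (hw _ z.2.1.2)).2 z.2.2⟩, z.2.1)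
      invFun := fun z => ⟨⟨z.1.1 - z.2.1, fun h =>
          z.1.2.1 (by simpa using add_mem h (hW z.2.2))⟩, z.2, by
          have hw : z.2.1 ∈ hermDual hF W := hW z.2.2
          refine (hermInner_add_self_eq_zero_iff hF (hw _ z.2.2)).1 ?_
          rw [sub_add_cancel]
          exact z.1.2.2⟩
      left_inv := fun z => by
        obtain ⟨⟨x, hx⟩, ⟨w, hw⟩⟩ := z
        have hxw : x + w.1 - w.1 = x := add_sub_cancel_right _ _
        dsimp only
        congr! 1
        · exact Subtype.ext hxw
        · congr! 1
          rw [hxw]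
      right_inv := fun z => by
        refine Prod.ext (Subtype.ext ?_) rfl
        exact sub_add_cancel _ _ }
  have hc := Nat.card_congr e
  rw [Nat.card_sigma, Nat.card_prod, card_submodule hF] at hc
  have hq := two_le_of_card_eq_sq hF
  have hsum : q * ∑ x : {x : Fin n → F // x ∉ hermDual hF W}, Nat.card
      {w : W // hermInner q w.1 x.1 + hermInner q w.1 x.1 ^ q = -hermInner q x.1 x.1} =
      Nat.card {x : Fin n → F // x ∉ hermDual hF W} * (q ^ 2) ^ m := by
    rw [Finset.mul_sum, Finset.sum_congr rfl fun x _ => mul_card_hermInner_add_pow_eq hF x.2 ?_]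
    · simp [m]
    · have := map_neg (conjHom hF) (hermInner q x.1 x.1)
      change (-hermInner q x.1 x.1) ^ q = -(hermInner q x.1 x.1) ^ q at this
      rw [this, hermInner_conj hF]
  rw [hc, ← mul_assoc] at hsum
  have := Nat.eq_of_mul_eq_mul_right (by positivity) hsum
  rw [hsplit, mul_add, this]
  omega

end Field

/-! ### Counting tuples and subspaces over a finite field -/

section Subspaces

variable {F V : Type*} [Field F] [Fintype F] [AddCommGroup V] [Module F V] [Finite V]

theorem card_linearIndependent_eq_prod (m : ℕ) :
    (Nat.card {s : Fin m → V // LinearIndependent F s} : ℝ) =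
      ∏ i ∈ Finset.range m,
        ((Fintype.card F : ℝ) ^ Module.finrank F V - (Fintype.card F : ℝ) ^ i) := by
  rcases le_or_gt m (Module.finrank F V) with h | h
  · rw [card_linearIndependent h, Nat.cast_prod, ← Fin.prod_univ_eq_prod_range
      (fun i => (Fintype.card F : ℝ) ^ Module.finrank F V - (Fintype.card F : ℝ) ^ i)]
    refine Finset.prod_congr rfl fun i _ => ?_
    rw [Nat.cast_sub (Nat.pow_le_pow_right Fintype.card_pos (i.2.le.trans h))]
    simp
  -- Too many vectors: the factor at `i = finrank` vanishes, and so does the count.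
  · rw [Finset.prod_eq_zero (Finset.mem_range.2 h) (sub_self _)]
    have : IsEmpty {s : Fin m → V // LinearIndependent F s} :=
      ⟨fun s => by simpa [not_le.2 h] using s.2.fintype_card_le_finrank⟩
    simp

theorem card_linearIndependent_mem (H : Submodule F V) (m : ℕ) :
    (Nat.card {s : Fin m → V // LinearIndependent F s ∧ ∀ i, s i ∈ H} : ℝ) =
      ∏ i ∈ Finset.range m,
        ((Fintype.card F : ℝ) ^ Module.finrank F H - (Fintype.card F : ℝ) ^ i) := by
  rw [← card_linearIndependent_eq_prod]
  congr 1
  refine Nat.card_congr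
    { toFun := fun s => ⟨fun i => ⟨s.1 i, s.2.2 i⟩, LinearIndependent.of_comp H.subtype s.2.1⟩
      invFun := fun s => ⟨fun i => (s.1 i : V),
        s.2.map' H.subtype H.ker_subtype, fun i => (s.1 i).2⟩
      left_inv := fun _ => rfl
      right_inv := fun _ => rfl }

omit [Fintype F] in
theorem span_range_eq_iff {m : ℕ} {s : Fin m → V} (hs : LinearIndependent F s)
    {C : Submodule F V} (hC : Module.finrank F C = m) :
    Submodule.span F (Set.range s) = C ↔ ∀ i, s i ∈ C := by
  constructor
  · rintro rfl i
    exact Submodule.subset_span ⟨i, rfl⟩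
  · intro h
    refine Submodule.eq_of_le_of_finrank_eq (Submodule.span_le.2 ?_) ?_
    · rintro _ ⟨i, rfl⟩
      exact h i
    · rw [finrank_span_eq_card hs, Fintype.card_fin, hC]

theorem prod_pow_sub_pow_pos {x : ℝ} (hx : 1 < x) (k : ℕ) :
    0 < ∏ i ∈ Finset.range k, (x ^ k - x ^ i) :=
  Finset.prod_pos fun _ hi => sub_pos.2 (pow_lt_pow_right₀ hx (Finset.mem_range.1 hi))

/-- The number of `k`-dimensional subspaces is a Gaussian binomial coefficient. -/
theorem card_finrank_eq (k : ℕ) :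
    (Nat.card {C : Submodule F V // Module.finrank F C = k} : ℝ) =
      gaussBinom (Fintype.card F) (Module.finrank F V) k := by
  classical
  have : Finite (Submodule F V) := Finite.of_injective _ SetLike.coe_injective
  have := Fintype.ofFinite {C : Submodule F V // Module.finrank F C = k}
  have hQ : (1 : ℝ) < Fintype.card F := by exact_mod_cast Fintype.one_lt_card
  rw [gaussBinom, eq_div_iff (prod_pow_sub_pow_pos hQ k).ne', ← card_linearIndependent_eq_prod]
  let f : {s : Fin k → V // LinearIndependent F s} →
      {C : Submodule F V // Module.finrank F C = k} := fun s =>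
    ⟨Submodule.span F (Set.range s.1), by rw [finrank_span_eq_card s.2, Fintype.card_fin]⟩
  rw [← Nat.card_congr (Equiv.sigmaFiberEquiv f), Nat.card_sigma, Nat.cast_sum,
    Finset.sum_congr rfl (g := fun _ => ∏ i ∈ Finset.range k,
      ((Fintype.card F : ℝ) ^ k - (Fintype.card F : ℝ) ^ i))]
  · rw [Finset.sum_const, nsmul_eq_mul, Finset.card_univ, Nat.card_eq_fintype_card]
  · intro C _
    have h := card_linearIndependent_mem C.1 k
    rw [C.2] at h
    rw [← h]
    congr 1
    exact Nat.card_congr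
      { toFun := fun s => ⟨s.1.1, s.1.2, (span_range_eq_iff s.1.2 C.2).1 (Subtype.ext_iff.1 s.2)⟩
        invFun := fun s => ⟨⟨s.1, s.2.1⟩,
          Subtype.ext ((span_range_eq_iff s.2.1 C.2).2 s.2.2)⟩
        left_inv := fun _ => rfl
        right_inv := fun _ => rfl }

omit [Fintype F] in
theorem finrank_comap_mkQ (W : Submodule F V) (D : Submodule F (V ⧸ W)) :
    Module.finrank F (D.comap W.mkQ) = Module.finrank F D + Module.finrank F W := by
  have h := (W.mkQ.domRestrict (D.comap W.mkQ)).finrank_range_add_finrank_ker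
  rw [LinearMap.range_domRestrict, Submodule.map_comap_eq_of_surjective W.mkQ_surjective,
    LinearMap.ker_domRestrict, Submodule.ker_mkQ] at h
  rw [← h, LinearEquiv.finrank_eq (Submodule.comapSubtypeEquivOfLe (W.le_comap_mkQ D))]

/-- Subspaces between `W` and `U` correspond to subspaces of `U / W`, with dimension lowered by that
of `W`. -/
theorem card_between {W U : Submodule F V} (hWU : W ≤ U) {k : ℕ} (hk : Module.finrank F W ≤ k) :
    (Nat.card {C : Submodule F V // Module.finrank F C = k ∧ W ≤ C ∧ C ≤ U} : ℝ) =
      gaussBinom (Fintype.card F) (Module.finrank F U - Module.finrank F W)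
        (k - Module.finrank F W) := by
  set W' : Submodule F U := W.comap U.subtype with hW'
  have hW'r : Module.finrank F W' = Module.finrank F W :=
    LinearEquiv.finrank_eq (Submodule.comapSubtypeEquivOfLe hWU)
  have hq : Module.finrank F (U ⧸ W') = Module.finrank F U - Module.finrank F W := by
    have := W'.finrank_quotient_add_finrank
    omega
  have : Finite (U ⧸ W') := Finite.of_surjective _ W'.mkQ_surjective
  rw [← hq, ← card_finrank_eq]
  congr 1
  have hdim (D : Submodule F (U ⧸ W')) :
      Module.finrank F ((D.comap W'.mkQ).map U.subtype) =
        Module.finrank F D + Module.finrank F W := by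
    rw [Submodule.finrank_map_subtype_eq, finrank_comap_mkQ, hW'r]
  have hright (C : Submodule F V) (h1 : W ≤ C) (h2 : C ≤ U) :
      (((C.comap U.subtype).map W'.mkQ).comap W'.mkQ).map U.subtype = C := by
    rw [Submodule.comap_map_mkQ, sup_eq_right.2 (Submodule.comap_mono h1),
      Submodule.map_comap_subtype, inf_eq_right.2 h2]
  have hle (D : Submodule F (U ⧸ W')) : W ≤ (D.comap W'.mkQ).map U.subtype :=
    calc W = W'.map U.subtype := by rw [Submodule.map_comap_subtype, inf_eq_right.2 hWU]
      _ ≤ _ := Submodule.map_mono (W'.le_comap_mkQ _)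
  have hleft (D : Submodule F (U ⧸ W')) :
      (((D.comap W'.mkQ).map U.subtype).comap U.subtype).map W'.mkQ = D := by
    rw [Submodule.comap_map_eq_of_injective U.subtype_injective,
      Submodule.map_comap_eq_of_surjective W'.mkQ_surjective]
  exact (Nat.card_congr
    { toFun := fun D => ⟨(D.1.comap W'.mkQ).map U.subtype,
        by rw [hdim, D.2, Nat.sub_add_cancel hk], hle D.1, U.map_subtype_le _⟩
      invFun := fun C => ⟨(C.1.comap U.subtype).map W'.mkQ, by
        have h := hdim ((C.1.comap U.subtype).map W'.mkQ)
        rw [hright C.1 C.2.2.1 C.2.2.2, C.2.1] at h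
        omega⟩
      left_inv := fun D => Subtype.ext (hleft D.1)
      right_inv := fun C => Subtype.ext (hright C.1 C.2.2.1 C.2.2.2) }).symm

end Subspaces

/-! ### Isotropic tuples and the double count of codes -/

section Tuples

variable {F : Type*} [Field F] [Fintype F] {q n : ℕ}

theorem mem_hermDual_span_range (hF : Fintype.card F = q ^ 2) {m : ℕ} {v : Fin m → Fin n → F}
    {x : Fin n → F} :
    x ∈ hermDual hF (Submodule.span F (Set.range v)) ↔ ∀ i, hermInner q (v i) x = 0 := by
  constructor
  · intro h i
    exact h _ (Submodule.subset_span ⟨i, rfl⟩)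
  · intro h
    have : Submodule.span F (Set.range v) ≤ LinearMap.ker (hermForm q x) := by
      rw [Submodule.span_le]
      rintro _ ⟨i, rfl⟩
      exact h i
    exact fun y hy => this hy

theorem span_range_le_hermDual (hF : Fintype.card F = q ^ 2) {m : ℕ} {v : Fin m → Fin n → F}
    (hv : ∀ i j, hermInner q (v i) (v j) = 0) :
    Submodule.span F (Set.range v) ≤ hermDual hF (Submodule.span F (Set.range v)) := by
  rw [Submodule.span_le]
  rintro _ ⟨j, rfl⟩
  exact (mem_hermDual_span_range hF).2 fun i => hv i j

/-- The linearly independent tuples of pairwise orthogonal isotropic vectors. -/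
abbrev IsotropicTuple (F : Type*) [Field F] (q n m : ℕ) : Type _ :=
  {v : Fin m → Fin n → F // LinearIndependent F v ∧ ∀ i j, hermInner q (v i) (v j) = 0}

/-- An isotropic tuple is extended by an isotropic vector in the dual of its span. -/
def isotropicTupleSuccEquiv (hF : Fintype.card F = q ^ 2) (m : ℕ) :
    IsotropicTuple F q n (m + 1) ≃ Σ s : IsotropicTuple F q n m,
      {x : Fin n → F // (x ∈ hermDual hF (Submodule.span F (Set.range s.1)) ∧
        hermInner q x x = 0) ∧ x ∉ Submodule.span F (Set.range s.1)} where
  toFun v := ⟨⟨Fin.tail v.1, by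
      have h := v.2.1
      rw [← Fin.cons_self_tail v.1, linearIndependent_finCons] at h
      exact h.1, fun i j => v.2.2 i.succ j.succ⟩, v.1 0,
    ⟨(mem_hermDual_span_range hF).2 fun i => v.2.2 i.succ 0, v.2.2 0 0⟩, by
      have h := v.2.1
      rw [← Fin.cons_self_tail v.1, linearIndependent_finCons] at h
      exact h.2⟩
  invFun z := ⟨Fin.cons z.2.1 z.1.1, by
      rw [linearIndependent_finCons]
      exact ⟨z.1.2.1, z.2.2.2⟩, by
      have h := (mem_hermDual_span_range hF).1 z.2.2.1.1
      intro i j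
      refine Fin.cases ?_ (fun i => ?_) i <;> refine Fin.cases ?_ (fun j => ?_) j
      · exact z.2.2.1.2
      · exact (hermInner_eq_zero_comm hF).1 (h j)
      · exact h i
      · exact z.1.2.2 i j⟩
  left_inv v := Subtype.ext (Fin.cons_self_tail v.1)
  right_inv z := rfl

/-- The number of extensions of an isotropic tuple of length `j` by one vector. -/
noncomputable def isoExt (q : ℝ) (n j : ℕ) : ℝ :=
  (q ^ (2 * n) / q ^ (2 * j) + (-1) ^ n * (q ^ (n + 1) - q ^ n)) / q - q ^ (2 * j)

theorem card_isotropic_extension (hF : Fintype.card F = q ^ 2) {m : ℕ}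
    (s : IsotropicTuple F q n m) :
    (Nat.card {x : Fin n → F // (x ∈ hermDual hF (Submodule.span F (Set.range s.1)) ∧
        hermInner q x x = 0) ∧ x ∉ Submodule.span F (Set.range s.1)} : ℝ) = isoExt q n m := by
  classical
  set W := Submodule.span F (Set.range s.1)
  have hW : W ≤ hermDual hF W := span_range_le_hermDual hF s.2.2
  have hm : Module.finrank F W = m := by
    rw [finrank_span_eq_card s.2.1, Fintype.card_fin]
  have hmn : m ≤ n := by
    have := W.finrank_le
    rwa [hm, Module.finrank_fin_fun] at this
  have hsplit : Nat.card {x : Fin n → F // x ∈ hermDual hF W ∧ hermInner q x x = 0} =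
      (q ^ 2) ^ m + Nat.card {x : Fin n → F // (x ∈ hermDual hF W ∧ hermInner q x x = 0) ∧
        x ∉ W} := by
    rw [← hm, ← card_submodule hF W]
    simp only [Nat.card_eq_fintype_card, Fintype.card_subtype]
    rw [← Finset.card_filter_add_card_filter_not (s := Finset.univ.filter
        fun x : Fin n → F => x ∈ hermDual hF W ∧ hermInner q x x = 0) (fun x => x ∈ W),
      Finset.filter_filter, Finset.filter_filter]
    congr 2
    ext x
    simp only [Finset.mem_filter, Finset.mem_univ, true_and]
    exact ⟨fun h => h.2, fun h => ⟨⟨hW h, hW h x h⟩, h⟩⟩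
  have h1 := mul_card_isotropic_hermDual hF hW
  rw [hsplit, hm] at h1
  generalize Nat.card {x : Fin n → F // (x ∈ hermDual hF W ∧ hermInner q x x = 0) ∧ x ∉ W} = N
    at h1 ⊢
  have h2 : (q : ℝ) * (((q : ℝ) ^ 2) ^ m + N) + ((q : ℝ) ^ 2) ^ n =
      q * isoCard F q n + ((q : ℝ) ^ 2) ^ (n - m) := by exact_mod_cast h1
  have hq : (q : ℝ) ≠ 0 := by exact_mod_cast ne_zero_of_card_eq_sq hF
  rw [mul_isoCard hF, ← pow_mul, ← pow_mul, ← pow_mul, Nat.mul_sub,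
    pow_sub₀ _ hq (by omega)] at h2
  rw [isoExt]
  field_simp at h2 ⊢
  linear_combination h2

/-- The number of one-vector extensions does not depend on the tuple. No bound on `m` is needed:
once no tuple of some length exists, the product is already zero. -/
theorem card_isotropicTuple (hF : Fintype.card F = q ^ 2) (m : ℕ) :
    (Nat.card (IsotropicTuple F q n m) : ℝ) = ∏ j ∈ Finset.range m, isoExt q n j := by
  classical
  induction m with
  | zero =>
    have : Unique (IsotropicTuple F q n 0) :=
      { default := ⟨Fin.elim0, linearIndependent_empty_type, fun i => i.elim0⟩
        uniq := fun v => Subtype.ext (Subsingleton.elim _ _) }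
    simp
  | succ m ih =>
    rw [Nat.card_congr (isotropicTupleSuccEquiv hF m), Nat.card_sigma, Nat.cast_sum,
      Finset.sum_congr rfl fun s _ => card_isotropic_extension hF s, Finset.sum_const,
      nsmul_eq_mul, Finset.prod_range_succ, ← ih, Finset.card_univ, Nat.card_eq_fintype_card]

instance finite_submodule_pi : Finite (Submodule F (Fin n → F)) :=
  Finite.of_injective _ SetLike.coe_injective

/-- Double counting of the pairs of a code and a linearly independent tuple in its hull. -/
theorem sum_prod_finrank_hermHull (hF : Fintype.card F = q ^ 2) {k m : ℕ} (hmk : m ≤ k)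
    [Fintype {C : Submodule F (Fin n → F) // Module.finrank F C = k}] :
    ∑ C : {C : Submodule F (Fin n → F) // Module.finrank F C = k},
      ∏ i ∈ Finset.range m,
        (((q : ℝ) ^ 2) ^ Module.finrank F (hermHull hF C.1) - ((q : ℝ) ^ 2) ^ i) =
      (∏ j ∈ Finset.range m, isoExt q n j) * gaussBinom ((q : ℝ) ^ 2) (n - m - m) (k - m) := by
  classical
  have hQ : (Fintype.card F : ℝ) = (q : ℝ) ^ 2 := by rw [hF, Nat.cast_pow]
  -- Duality is order-reversing and symmetric, so lying in `C^⊥` becomes the upper bound `C ≤ W^⊥`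
  -- for the span `W`.
  have key (C : Submodule F (Fin n → F)) (v : Fin m → Fin n → F) : (∀ i, v i ∈ hermHull hF C) ↔
      Submodule.span F (Set.range v) ≤ C ∧ C ≤ hermDual hF (Submodule.span F (Set.range v)) := by
    rw [le_hermDual_comm hF, ← le_inf_iff, Submodule.span_le, Set.range_subset_iff]
    rfl
  have e : (Σ C : {C : Submodule F (Fin n → F) // Module.finrank F C = k},
      {v : Fin m → Fin n → F // LinearIndependent F v ∧ ∀ i, v i ∈ hermHull hF C.1}) ≃
      Σ v : IsotropicTuple F q n m, {C : Submodule F (Fin n → F) // Module.finrank F C = k ∧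
        Submodule.span F (Set.range v.1) ≤ C ∧
          C ≤ hermDual hF (Submodule.span F (Set.range v.1))} :=
    { toFun := fun z => ⟨⟨z.2.1, z.2.2.1, fun i j =>
          (mem_hermDual hF).1 (z.2.2.2 j).2 _ (z.2.2.2 i).1⟩, z.1.1, z.1.2,
          (key _ _).1 z.2.2.2⟩
      invFun := fun z => ⟨⟨z.2.1, z.2.2.1⟩, z.1.1, z.1.2.1, (key _ _).2 z.2.2.2⟩
      left_inv := fun _ => rfl
      right_inv := fun _ => rfl }
  have h := congrArg (Nat.cast : ℕ → ℝ) (Nat.card_congr e)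
  rw [Nat.card_sigma, Nat.card_sigma, Nat.cast_sum, Nat.cast_sum,
    Finset.sum_congr rfl fun C _ => card_linearIndependent_mem (hermHull hF C.1) m, hQ] at h
  rw [h, ← card_isotropicTuple hF, Finset.sum_congr rfl (g := fun _ =>
    gaussBinom ((q : ℝ) ^ 2) (n - m - m) (k - m))]
  · rw [Finset.sum_const, nsmul_eq_mul, Finset.card_univ, Nat.card_eq_fintype_card]
  · intro v _
    have hm : Module.finrank F (Submodule.span F (Set.range v.1)) = m := by
      rw [finrank_span_eq_card v.2.1, Fintype.card_fin]
    have hd := finrank_hermDual hF (Submodule.span F (Set.range v.1))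
    rw [card_between (span_range_le_hermDual hF v.2.2) (hm.trans_le hmk), hQ, hm,
      show Module.finrank F (hermDual hF (Submodule.span F (Set.range v.1))) = n - m by omega]

/-- Grouping the double count by hull dimension gives one linear equation in the numbers `|HHull|`
for each `m`. -/
theorem sum_ncard_HHull_mul_prod (hF : Fintype.card F = q ^ 2) {k m : ℕ} (hmk : m ≤ k) :
    ∑ s ∈ Finset.range (n + 1), ((HHull hF n k s).ncard : ℝ) *
      ∏ i ∈ Finset.range m, (((q : ℝ) ^ 2) ^ s - ((q : ℝ) ^ 2) ^ i) =
      (∏ j ∈ Finset.range m, isoExt q n j) * gaussBinom ((q : ℝ) ^ 2) (n - m - m) (k - m) := by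
  classical
  have := Fintype.ofFinite {C : Submodule F (Fin n → F) // Module.finrank F C = k}
  rw [← sum_prod_finrank_hermHull hF hmk, ← Finset.sum_fiberwise_of_maps_to
    (t := Finset.range (n + 1))
    (g := fun C : {C : Submodule F (Fin n → F) // Module.finrank F C = k} => Module.finrank F (hermHull hF C.1))]
  · refine Finset.sum_congr rfl fun s _ => ?_
    rw [Finset.sum_congr rfl (g := fun _ => ∏ i ∈ Finset.range m,
      (((q : ℝ) ^ 2) ^ s - ((q : ℝ) ^ 2) ^ i)), Finset.sum_const, nsmul_eq_mul]
    · congr 2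
      rw [← Fintype.card_subtype, ← Nat.card_eq_fintype_card, ← Nat.card_coe_set_eq]
      exact Nat.card_congr (Equiv.subtypeSubtypeEquivSubtypeInter
        (fun C : Submodule F (Fin n → F) => Module.finrank F C = k)
        (fun C => Module.finrank F (hermHull hF C) = s)).symm
    · intro C hC
      rw [(Finset.mem_filter.1 hC).2]
  · intro C _
    have := (hermHull hF C.1).finrank_le
    rw [Module.finrank_fin_fun] at this
    exact Finset.mem_range.2 (by omega)

theorem ncard_HHull_eq_zero_of_lt (hF : Fintype.card F = q ^ 2) {k s : ℕ}
    (h : k < s ∨ n < k + s) : (HHull hF n k s).ncard = 0 := by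
  have : HHull hF n k s = ∅ := by
    refine Set.eq_empty_of_forall_notMem fun C hC => ?_
    obtain ⟨hk, hs⟩ := hC
    have h1 : Module.finrank F (hermHull hF C) ≤ _ := Submodule.finrank_mono inf_le_left
    have h2 : Module.finrank F (hermHull hF C) ≤ _ := Submodule.finrank_mono inf_le_right
    have h3 := finrank_hermDual hF C
    omega
  rw [this, Set.ncard_empty]

end Tuples

/-! ### Gaussian binomial coefficients -/

section Gauss

theorem hProd_succ (x : ℝ) (n : ℕ) : hProd x (n + 1) = hProd x n * (x ^ (n + 1) - 1) :=
  Finset.prod_Icc_succ_top (by omega) _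

theorem gSeq_succ (x : ℝ) (n : ℕ) : gSeq x (n + 1) = gSeq x n * (1 - 1 / x ^ (n + 1)) :=
  Finset.prod_Icc_succ_top (by omega) _

@[simp] theorem hProd_zero (x : ℝ) : hProd x 0 = 1 := by simp [hProd]

@[simp] theorem gSeq_zero (x : ℝ) : gSeq x 0 = 1 := by simp [gSeq]

theorem choose_succ_two (n : ℕ) : (n + 1).choose 2 = n + n.choose 2 := by
  rw [Nat.choose_succ_succ', Nat.choose_one_right]

theorem choose_two_mul_two_add (n : ℕ) : n.choose 2 * 2 + n = n * n := by
  induction n with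
  | zero => rfl
  | succ n ih => rw [choose_succ_two]; linarith

variable {x : ℝ}

theorem hProd_pos (hx : 1 < x) (n : ℕ) : 0 < hProd x n := by
  induction n with
  | zero => simp
  | succ n ih =>
    rw [hProd_succ]
    exact mul_pos ih (sub_pos.2 (one_lt_pow₀ hx (Nat.succ_ne_zero n)))

theorem hProd_eq_mul_gSeq (hx : 1 < x) (n : ℕ) :
    hProd x n = x ^ (n + 1).choose 2 * gSeq x n := by
  have hx0 : x ≠ 0 := by positivity
  induction n with
  | zero => simp
  | succ n ih =>
    rw [hProd_succ, ih, gSeq_succ, choose_succ_two (n + 1), pow_add x (n + 1)]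
    field_simp

/-- Pulling `x ^ i` out of the `i`-th factor contributes `x ^ k.choose 2` and leaves the top `k`
factors of `hProd x (a + k)`. -/
theorem prod_pow_sub_pow_mul_hProd (x : ℝ) (a k : ℕ) :
    (∏ i ∈ Finset.range k, (x ^ (a + k) - x ^ i)) * hProd x a =
      x ^ k.choose 2 * hProd x (a + k) := by
  induction k with
  | zero => simp
  | succ k ih =>
    have : ∀ i, x ^ (a + (k + 1)) - x ^ (i + 1) = x * (x ^ (a + k) - x ^ i) := fun i => by ring
    rw [Finset.prod_range_succ', Finset.prod_congr rfl fun i _ => this i, Finset.prod_mul_distrib,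
      Finset.prod_const, Finset.card_range, choose_succ_two, ← add_assoc, hProd_succ, pow_add x k]
    linear_combination x ^ k * (x ^ (a + k + 1) - 1) * ih

theorem gaussBinom_mul_prod (hx : 1 < x) (s m : ℕ) :
    gaussBinom x s m * ∏ i ∈ Finset.range m, (x ^ m - x ^ i) =
      ∏ i ∈ Finset.range m, (x ^ s - x ^ i) :=
  div_mul_cancel₀ _ (prod_pow_sub_pow_pos hx m).ne'

theorem prod_pow_sub_pow_self (x : ℝ) (m : ℕ) :
    ∏ i ∈ Finset.range m, (x ^ m - x ^ i) = x ^ m.choose 2 * hProd x m := by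
  simpa using prod_pow_sub_pow_mul_hProd x 0 m

theorem gaussBinom_add (hx : 1 < x) (a b : ℕ) :
    gaussBinom x (a + b) b = hProd x (a + b) / (hProd x a * hProd x b) := by
  have h1 := gaussBinom_mul_prod hx (a + b) b
  have h2 := prod_pow_sub_pow_mul_hProd x a b
  rw [← h1, prod_pow_sub_pow_self] at h2
  have := hProd_pos hx a
  have := hProd_pos hx b
  have hp : x ^ b.choose 2 ≠ 0 := by positivity
  rw [eq_div_iff (by positivity)]
  apply mul_left_cancel₀ hp
  linear_combination h2

theorem gaussBinom_eq_zero {s m : ℕ} (h : s < m) : gaussBinom x s m = 0 := by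
  rw [gaussBinom, Finset.prod_eq_zero (Finset.mem_range.2 h) (sub_self _), zero_div]

theorem gaussBinom_zero_right (n : ℕ) : gaussBinom x n 0 = 1 := by simp [gaussBinom]

theorem gaussBinom_self (hx : 1 < x) (n : ℕ) : gaussBinom x n n = 1 :=
  div_self (prod_pow_sub_pow_pos hx n).ne'

theorem gaussBinom_pascal (hx : 1 < x) (t j : ℕ) :
    gaussBinom x (t + 1) (j + 1) = gaussBinom x t j + x ^ (j + 1) * gaussBinom x t (j + 1) := by
  rcases lt_trichotomy t j with h | rfl | h
  · simp [gaussBinom_eq_zero h, gaussBinom_eq_zero (Nat.succ_lt_succ h),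
      gaussBinom_eq_zero (h.trans (Nat.lt_succ_self j))]
  · simp [gaussBinom_self hx, gaussBinom_eq_zero (Nat.lt_succ_self t)]
  · obtain ⟨a, rfl⟩ := Nat.exists_eq_add_of_lt h
    have e1 := gaussBinom_add hx (a + 1) (j + 1)
    have e2 := gaussBinom_add hx (a + 1) j
    have e3 := gaussBinom_add hx a (j + 1)
    rw [show a + 1 + (j + 1) = j + a + 1 + 1 by ring] at e1
    rw [show a + 1 + j = j + a + 1 by ring] at e2
    rw [show a + (j + 1) = j + a + 1 by ring] at e3
    rw [e1, e2, e3, hProd_succ x (j + a + 1), hProd_succ x a, hProd_succ x j]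
    have h1 := (hProd_pos hx a).ne'
    have h2 := (hProd_pos hx j).ne'
    have h3 : x ^ (a + 1) - 1 ≠ 0 := (sub_pos.2 (one_lt_pow₀ hx (Nat.succ_ne_zero a))).ne'
    have h4 : x ^ (j + 1) - 1 ≠ 0 := (sub_pos.2 (one_lt_pow₀ hx (Nat.succ_ne_zero j))).ne'
    field_simp
    ring

/-- By Pascal's rule the partial alternating sums telescope; the closed form vanishes as soon as `J
> t`. -/
theorem sum_alternating_gaussBinom_succ (hx : 1 < x) (t J : ℕ) :
    ∑ j ∈ Finset.range (J + 1), (-1) ^ j * x ^ j.choose 2 * gaussBinom x (t + 1) j =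
      (-1) ^ J * x ^ (J + 1).choose 2 * gaussBinom x t J := by
  induction J with
  | zero => simp [gaussBinom_zero_right]
  | succ J ih =>
    rw [Finset.sum_range_succ, ih, gaussBinom_pascal hx, choose_succ_two (J + 1)]
    ring

/-- Both sides count flags of dimensions `l` and `l + j` in a space of dimension `l + t`. -/
theorem gaussBinom_mul_gaussBinom (hx : 1 < x) (l t j : ℕ) :
    gaussBinom x (l + j) l * gaussBinom x (l + t) (l + j) =
      gaussBinom x (l + t) l * gaussBinom x t j := by
  rcases lt_or_ge t j with h | h
  · rw [gaussBinom_eq_zero h, gaussBinom_eq_zero (Nat.add_lt_add_left h l)]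
    simp
  · obtain ⟨a, rfl⟩ := Nat.exists_eq_add_of_le' h
    have e1 := gaussBinom_add hx j l
    have e2 := gaussBinom_add hx a (l + j)
    have e3 := gaussBinom_add hx (a + j) l
    have e4 := gaussBinom_add hx a j
    rw [add_comm j l] at e1
    rw [show a + (l + j) = l + (a + j) by ring] at e2
    rw [show a + j + l = l + (a + j) by ring] at e3
    rw [e1, e2, e3, e4]
    have h1 := (hProd_pos hx a).ne'
    have h2 := (hProd_pos hx j).ne'
    have h3 := (hProd_pos hx l).ne'
    have h4 := (hProd_pos hx (a + j)).ne'
    have h5 := (hProd_pos hx (l + j)).ne'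
    field_simp

/-- Orthogonality behind the inversion: the flag identity pulls out the factor free of `j`, leaving
the full alternating sum of row `s - l`, which is zero unless `s = l`. -/
theorem sum_alternating_gaussBinom_mul (hx : 1 < x) {n s l : ℕ} (hs : s ≤ n) :
    ∑ j ∈ Finset.range (n + 1), (-1) ^ j * x ^ j.choose 2 * gaussBinom x (l + j) l *
      gaussBinom x s (l + j) = if s = l then 1 else 0 := by
  rcases lt_or_ge s l with h | h
  · rw [if_neg h.ne]
    refine Finset.sum_eq_zero fun j _ => ?_
    rw [gaussBinom_eq_zero (show s < l + j by omega), mul_zero]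
  · obtain ⟨t, rfl⟩ := Nat.exists_eq_add_of_le h
    have e : ∀ j, (-1) ^ j * x ^ j.choose 2 * gaussBinom x (l + j) l * gaussBinom x (l + t) (l + j)
        = gaussBinom x (l + t) l * ((-1) ^ j * x ^ j.choose 2 * gaussBinom x t j) := fun j => by
      rw [mul_assoc, gaussBinom_mul_gaussBinom hx]
      ring
    rw [Finset.sum_congr rfl fun j _ => e j, ← Finset.mul_sum]
    rcases t with _ | t
    · rw [Finset.sum_eq_single_of_mem 0 (by simp)
        fun j _ hj => by rw [gaussBinom_eq_zero (Nat.pos_of_ne_zero hj), mul_zero]]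
      simp [gaussBinom_self hx]
    · rw [sum_alternating_gaussBinom_succ hx, gaussBinom_eq_zero (show t < n by omega)]
      simp

/-- Inversion of the `x`-binomial transform. -/
theorem eq_sum_alternating_binomial_transform (hx : 1 < x) (A : ℕ → ℝ) {n l : ℕ} (hl : l ≤ n) :
    A l = ∑ j ∈ Finset.range (n + 1), (-1) ^ j * x ^ j.choose 2 * gaussBinom x (l + j) l *
      ∑ s ∈ Finset.range (n + 1), A s * gaussBinom x s (l + j) := by
  simp_rw [Finset.mul_sum]
  rw [Finset.sum_comm]
  have e : ∀ s ∈ Finset.range (n + 1), ∑ j ∈ Finset.range (n + 1),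
      (-1) ^ j * x ^ j.choose 2 * gaussBinom x (l + j) l * (A s * gaussBinom x s (l + j)) =
      if s = l then A s else 0 := by
    intro s hs
    rw [← mul_boole, ← sum_alternating_gaussBinom_mul hx (Finset.mem_range_succ_iff.1 hs),
      Finset.mul_sum]
    exact Finset.sum_congr rfl fun j _ => by ring
  rw [Finset.sum_congr rfl e, Finset.sum_ite_eq' , if_pos (Finset.mem_range.2 (by omega))]

/-- Separates the exact power of `x` from a factor that converges. -/
theorem gaussBinom_add_eq_gSeq (hx : 1 < x) (a b : ℕ) :
    gaussBinom x (a + b) a = x ^ (a * b) * (gSeq x (a + b) / (gSeq x a * gSeq x b)) := by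
  have e := gaussBinom_add hx b a
  rw [add_comm b a] at e
  have hc : (a + b + 1).choose 2 = a * b + (a + 1).choose 2 + (b + 1).choose 2 := by
    have h1 := choose_two_mul_two_add (a + b + 1)
    have h2 := choose_two_mul_two_add (a + 1)
    have h3 := choose_two_mul_two_add (b + 1)
    nlinarith
  rw [e]
  simp only [hProd_eq_mul_gSeq hx, hc, pow_add]
  have hx0 : x ≠ 0 := by positivity
  field_simp

/-! ### Bounds for `g` and Euler's identity -/

theorem gSeq_pos (hx : 1 < x) (n : ℕ) : 0 < gSeq x n := by
  have h := hProd_pos hx n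
  rw [hProd_eq_mul_gSeq hx] at h
  exact pos_of_mul_pos_right h (by positivity)

theorem gSeq_antitone (hx : 1 < x) : Antitone (gSeq x) := by
  refine antitone_nat_of_succ_le fun n => ?_
  rw [gSeq_succ]
  have : 0 < 1 / x ^ (n + 1) := by positivity
  exact mul_le_of_le_one_right (gSeq_pos hx n).le (by linarith)

theorem gSeq_le_one (hx : 1 < x) (n : ℕ) : gSeq x n ≤ 1 := by
  simpa using gSeq_antitone hx (Nat.zero_le n)

theorem gInf_le_gSeq (hx : 1 < x) (n : ℕ) : gInf x ≤ gSeq x n :=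
  (gSeq_antitone hx).le_of_tendsto (gSeq_tendsto_and_pos hx).1 n

theorem abs_pow_div_gSeq_le (hx : 1 < x) (z : ℝ) (j : ℕ) :
    |z ^ j / gSeq x j| ≤ |z| ^ j / gInf x := by
  rw [abs_div, abs_pow, abs_of_pos (gSeq_pos hx j)]
  exact div_le_div_of_nonneg_left (by positivity) (gSeq_tendsto_and_pos hx).2 (gInf_le_gSeq hx j)

theorem summable_abs_pow_div_gInf {z : ℝ} (hz : |z| < 1) (x : ℝ) :
    Summable fun j : ℕ => |z| ^ j / gInf x :=
  (summable_geometric_of_lt_one (abs_nonneg z) hz).div_const _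

theorem summable_pow_div_gSeq (hx : 1 < x) {z : ℝ} (hz : |z| < 1) :
    Summable fun j : ℕ => z ^ j / gSeq x j :=
  Summable.of_norm_bounded (summable_abs_pow_div_gInf hz x) (abs_pow_div_gSeq_le hx z)

/-- The functional equation of `∑ z ^ j / g_j`. -/
theorem tsum_pow_div_gSeq_div (hx : 1 < x) {z : ℝ} (hz : |z| < 1) :
    ∑' j : ℕ, (z / x) ^ j / gSeq x j = (1 - z) * ∑' j : ℕ, z ^ j / gSeq x j := by
  have hx0 : 0 < x := by positivity
  have hz' : |z / x| < 1 := by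
    rw [abs_div, abs_of_pos hx0, div_lt_one hx0]
    exact hz.trans hx
  have hs := summable_pow_div_gSeq hx hz
  have hs' := summable_pow_div_gSeq hx hz'
  have h : ∑' j : ℕ, (z ^ j / gSeq x j - (z / x) ^ j / gSeq x j) =
      z * ∑' j : ℕ, z ^ j / gSeq x j := by
    rw [(hs.sub hs').tsum_eq_zero_add, ← tsum_mul_left]
    simp only [pow_zero, sub_self, zero_add]
    refine tsum_congr fun j => ?_
    rw [gSeq_succ, div_pow]
    have h1 := (gSeq_pos hx j).ne'
    have h2 : x ^ (j + 1) - 1 ≠ 0 := (sub_pos.2 (one_lt_pow₀ hx (Nat.succ_ne_zero j))).ne'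
    have h3 : 1 - 1 / x ^ (j + 1) ≠ 0 := by
      rw [one_sub_div (by positivity)]
      exact div_ne_zero h2 (by positivity)
    field_simp
    ring
  rw [hs.tsum_sub hs'] at h
  linear_combination -h

/-- For odd exponents `1 + y = (1 - y^2) / (1 - y)`; the even exponents supply what completes both
products to values of `gSeq`. -/
theorem prod_one_add_odd_mul_gSeq (hx : 1 < x) (N : ℕ) :
    (∏ i ∈ Finset.range N, (1 + 1 / x ^ (2 * i + 1))) * gSeq x (2 * N) * gSeq (x ^ 4) N =
      gSeq (x ^ 2) (2 * N) * gSeq (x ^ 2) N := by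
  have hx0 : x ≠ 0 := by positivity
  induction N with
  | zero => simp
  | succ N ih =>
    rw [Finset.prod_range_succ, mul_add_one 2 N, gSeq_succ x (2 * N + 1), gSeq_succ x (2 * N),
      gSeq_succ (x ^ 2) (2 * N + 1), gSeq_succ (x ^ 2) (2 * N), gSeq_succ _ N, gSeq_succ _ N]
    have e : (1 + 1 / x ^ (2 * N + 1)) * (1 - 1 / x ^ (2 * N + 1)) * (1 - 1 / x ^ (2 * N + 1 + 1)) *
        (1 - 1 / (x ^ 4) ^ (N + 1)) = (1 - 1 / (x ^ 2) ^ (2 * N + 1)) *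
        (1 - 1 / (x ^ 2) ^ (2 * N + 1 + 1)) * (1 - 1 / (x ^ 2) ^ (N + 1)) := by
      field_simp
      ring
    linear_combination (∏ i ∈ Finset.range N, (1 + 1 / x ^ (2 * i + 1))) * gSeq x (2 * N) *
      gSeq (x ^ 4) N * e + (1 - 1 / (x ^ 2) ^ (2 * N + 1)) *
        (1 - 1 / (x ^ 2) ^ (2 * N + 1 + 1)) * (1 - 1 / (x ^ 2) ^ (N + 1)) * ih

/-- Iterating the functional equation from `z = -1/x` by steps `z ↦ z / x^2` collects the factors `1
+ x^{-(2i+1)}`, while the series tends to its constant term 1 as `z → 0`. -/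
theorem tsum_neg_inv_pow_div_gSeq (hx : 1 < x) :
    ∑' j : ℕ, (-1 / x) ^ j / gSeq (x ^ 2) j =
      gInf x * gInf (x ^ 4) / (gInf (x ^ 2) * gInf (x ^ 2)) := by
  have hx0 : 0 < x := by positivity
  have hx2 : 1 < x ^ 2 := one_lt_pow₀ hx two_ne_zero
  have hx4 : 1 < x ^ 4 := one_lt_pow₀ hx (by norm_num)
  set E : ℝ → ℝ := fun z => ∑' j : ℕ, z ^ j / gSeq (x ^ 2) j with hE
  have habs (N : ℕ) : |-1 / x ^ (2 * N + 1)| = 1 / x ^ (2 * N + 1) := by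
    rw [neg_div, abs_neg, abs_of_pos (by positivity)]
  have hprod (N : ℕ) : E (-1 / x ^ (2 * N + 1)) =
      E (-1 / x) * ∏ i ∈ Finset.range N, (1 + 1 / x ^ (2 * i + 1)) := by
    induction N with
    | zero => simp
    | succ N ih =>
      have h := tsum_pow_div_gSeq_div hx2 (z := -1 / x ^ (2 * N + 1)) (by
        rw [habs, div_lt_one (by positivity)]
        exact one_lt_pow₀ hx (by omega))
      rw [div_div, ← pow_add] at h
      rw [Finset.prod_range_succ, ← mul_assoc, ← ih]
      refine h.trans ?_
      rw [hE]
      ring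
  have hlim : Tendsto (fun N : ℕ => E (-1 / x ^ (2 * N + 1))) atTop (𝓝 1) := by
    have h1 : ∑' j : ℕ, (if j = 0 then (1 : ℝ) else 0) = 1 := by simp
    suffices hk : Tendsto (fun N : ℕ => E (-1 / x ^ (2 * N + 1))) atTop
        (𝓝 (∑' j : ℕ, (if j = 0 then (1 : ℝ) else 0))) by rwa [h1] at hk
    refine tendsto_tsum_of_dominated_convergence (bound := fun j => |-1 / x| ^ j / gInf (x ^ 2))
      (summable_abs_pow_div_gInf ?_ _) (fun j => ?_) (Eventually.of_forall fun N j => ?_)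
    · rw [neg_div, abs_neg, abs_of_pos (by positivity), div_lt_one hx0]
      exact hx
    · have hz : Tendsto (fun N : ℕ => -1 / x ^ (2 * N + 1)) atTop (𝓝 0) := by
        refine Tendsto.const_div_atTop ?_ _
        exact (tendsto_pow_atTop_atTop_of_one_lt hx).comp
          (tendsto_atTop_mono (fun N => show N ≤ _ by omega) tendsto_id)
      rcases Nat.eq_zero_or_pos j with rfl | hj
      · simp
      · rw [if_neg hj.ne']
        have := (hz.pow j).div_const (gSeq (x ^ 2) j)
        rwa [zero_pow hj.ne', zero_div] at this
    · refine (abs_pow_div_gSeq_le hx2 _ j).trans ?_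
      refine div_le_div_of_nonneg_right ?_ (gSeq_tendsto_and_pos hx2).2.le
      refine pow_le_pow_left₀ (abs_nonneg _) ?_ j
      rw [habs, neg_div, abs_neg, abs_of_pos (by positivity)]
      refine one_div_le_one_div_of_le hx0 ?_
      exact le_self_pow₀ hx.le (by omega)
  have h2N : Tendsto (fun N : ℕ => 2 * N) atTop atTop :=
    tendsto_atTop_mono (fun N => show N ≤ _ by omega) tendsto_id
  obtain ⟨t1, -⟩ := gSeq_tendsto_and_pos hx
  obtain ⟨t2, p2⟩ := gSeq_tendsto_and_pos hx2
  obtain ⟨t4, -⟩ := gSeq_tendsto_and_pos hx4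
  have hL := (hlim.mul (t1.comp h2N)).mul t4
  have hR := ((t2.comp h2N).mul t2).const_mul (E (-1 / x))
  have heq : (fun N => E (-1 / x ^ (2 * N + 1)) * (gSeq x ∘ fun N => 2 * N) N * gSeq (x ^ 4) N) =
      fun N => E (-1 / x) * ((gSeq (x ^ 2) ∘ fun N => 2 * N) N * gSeq (x ^ 2) N) := by
    funext N
    simp only [Function.comp]
    rw [← prod_one_add_odd_mul_gSeq hx, hprod]
    ring
  rw [heq] at hL
  rw [eq_div_iff (by positivity)]
  have := tendsto_nhds_unique hR hL
  rw [one_mul] at this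
  exact this

end Gauss

/-! ### Uniform bounds and limits of the normalised moments -/

section Limit

/-- Reparametrises by `k` and `c = n - k`; along `codeLimit` eventually `k ≤ n`, so truncated
subtraction is harmless. -/
theorem tendsto_codeLimit {f : ℕ × ℕ → ℝ} {L : Filter ℝ}
    (h : Tendsto (fun p : ℕ × ℕ => f (p.1 + p.2, p.1)) (atTop ×ˢ atTop) L) :
    Tendsto f codeLimit L := by
  have h1 : Tendsto (fun p : ℕ × ℕ => p.2) codeLimit atTop :=
    tendsto_comap.mono_left inf_le_left
  have h2 : Tendsto (fun p : ℕ × ℕ => (p.1 : ℤ) - p.2) codeLimit atTop :=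
    tendsto_comap.mono_left inf_le_right
  have h3 : Tendsto (fun p : ℕ × ℕ => p.1 - p.2) codeLimit atTop := by
    refine tendsto_atTop.2 fun N => ?_
    filter_upwards [tendsto_atTop.1 h2 (N : ℤ)] with p hp
    omega
  refine (h.comp (h1.prodMk h3)).congr' ?_
  filter_upwards [tendsto_atTop.1 h2 0] with p hp
  simp only [Function.comp]
  congr 2
  omega

/-- `isoExt` divided by its leading term. -/
noncomputable def isoRatio (q : ℝ) (n j : ℕ) : ℝ :=
  isoExt q n j * q ^ (2 * j + 1) / q ^ (2 * n)

variable {q : ℝ}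

theorem isoRatio_eq (hq : 1 < q) (n j : ℕ) :
    isoRatio q n j = 1 + (-1) ^ n * ((q - 1) * q ^ (2 * j)) / q ^ n
      - q ^ (4 * j + 1) / q ^ n / q ^ n := by
  have hq0 : q ≠ 0 := by positivity
  rw [isoRatio, isoExt]
  field_simp
  ring

theorem tendsto_isoRatio (hq : 1 < q) (j : ℕ) :
    Tendsto (fun n => isoRatio q n j) atTop (𝓝 1) := by
  have hp : Tendsto (fun n : ℕ => q ^ n) atTop atTop := tendsto_pow_atTop_atTop_of_one_lt hq
  have h1 : Tendsto (fun n : ℕ => (-1) ^ n * ((q - 1) * q ^ (2 * j)) / q ^ n) atTop (𝓝 0) := by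
    refine squeeze_zero_norm (a := fun n => |(q - 1) * q ^ (2 * j)| / q ^ n) (fun n => ?_)
      (hp.const_div_atTop _)
    rw [Real.norm_eq_abs, abs_div, abs_mul, abs_pow, abs_neg, abs_one, one_pow, one_mul,
      abs_of_pos (show 0 < q ^ n by positivity)]
  have h2 : Tendsto (fun n : ℕ => q ^ (4 * j + 1) / q ^ n / q ^ n) atTop (𝓝 0) :=
    (hp.const_div_atTop _).div_atTop hp
  simp_rw [isoRatio_eq hq]
  simpa using (h1.const_add 1).sub h2

theorem abs_isoRatio_le (hq : 1 < q) {n j : ℕ} (h : 2 * j + 1 ≤ n) :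
    |isoRatio q n j| ≤ 1 + q ^ (2 * j + 1) / q ^ n := by
  have hq0 : 0 < q := by positivity
  set y := q ^ (2 * j + 1) / q ^ n with hy
  have hy0 : 0 < y := by positivity
  have hy1 : y ≤ 1 := (div_le_one (by positivity)).2 (pow_le_pow_right₀ hq.le h)
  have e1 : (-1) ^ n * ((q - 1) * q ^ (2 * j)) / q ^ n = (-1) ^ n * (y - y / q) := by
    rw [hy]
    field_simp
    ring
  have e2 : q ^ (4 * j + 1) / q ^ n / q ^ n = y * y / q := by
    rw [hy]
    field_simp
    ring
  have h3 : y / q ≤ y := div_le_self hy0.le hq.le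
  have h4 : y * y / q ≤ y / q := by
    gcongr
    nlinarith
  have h5 : 0 ≤ y * y / q := by positivity
  rw [isoRatio_eq hq, e1, e2, abs_le]
  rcases neg_one_pow_eq_or ℝ n with hn | hn <;> rw [hn] <;> constructor <;> linarith

/-- Since `2 * m ≤ n`, the `j`-th factor is at most `1 + u ≤ (1 - u)⁻¹` with `u = q^{-(m-j)}`.
Reversing the order gives `1 / g_{q,m}`, so the bound is uniform in `n` and `m`. -/
theorem abs_prod_isoRatio_le (hq : 1 < q) {n m : ℕ} (h : 2 * m ≤ n) :
    |∏ j ∈ Finset.range m, isoRatio q n j| ≤ 1 / gInf q := by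
  have hq0 : 0 < q := by positivity
  have hfac (i : ℕ) : 0 < 1 - 1 / q ^ (i + 1) := by
    rw [sub_pos, div_lt_one (by positivity)]
    exact one_lt_pow₀ hq (Nat.succ_ne_zero i)
  have hg : gSeq q m = ∏ j ∈ Finset.range m, (1 - 1 / q ^ (j + 1)) := by
    clear h
    induction m with
    | zero => simp
    | succ m ih => rw [gSeq_succ, ih, Finset.prod_range_succ]
  rw [Finset.abs_prod]
  calc ∏ j ∈ Finset.range m, |isoRatio q n j|
      ≤ ∏ j ∈ Finset.range m, (1 - 1 / q ^ (m - 1 - j + 1))⁻¹ := by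
        refine Finset.prod_le_prod (fun _ _ => abs_nonneg _) fun j hj => ?_
        have hjm := Finset.mem_range.1 hj
        refine (abs_isoRatio_le hq (by omega)).trans ?_
        have hle : q ^ (2 * j + 1) / q ^ n ≤ 1 / q ^ (m - 1 - j + 1) := by
          rw [div_le_div_iff₀ (by positivity) (by positivity), one_mul, ← pow_add]
          exact pow_le_pow_right₀ hq.le (by omega)
        have h1 := hfac (m - 1 - j)
        rw [← one_div, le_div_iff₀ h1]
        have h2 : 0 < 1 / q ^ (m - 1 - j + 1) := by positivity
        nlinarith
    _ = 1 / gSeq q m := by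
        rw [Finset.prod_inv_distrib, Finset.prod_range_reflect (fun j => 1 - 1 / q ^ (j + 1)) m,
          ← hg, one_div]
    _ ≤ 1 / gInf q := one_div_le_one_div_of_le (gSeq_tendsto_and_pos hq).2 (gInf_le_gSeq hq m)

/-- The `m`-th binomial moment of the hull dimension of a random `[k + c, k]` code, divided by its
limit. -/
noncomputable def momentRatio (q : ℝ) (m k c : ℕ) : ℝ :=
  if m ≤ k ∧ m ≤ c then
    (∏ j ∈ Finset.range m, isoRatio q (k + c) j) *
      (gSeq (q ^ 2) (k + c - m - m) * (gSeq (q ^ 2) k * gSeq (q ^ 2) c) /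
        (gSeq (q ^ 2) (k - m) * gSeq (q ^ 2) (c - m) * gSeq (q ^ 2) (k + c)))
  else 0

theorem abs_momentRatio_le (hq : 1 < q) (m k c : ℕ) :
    |momentRatio q m k c| ≤ 1 / gInf q * (1 / gInf (q ^ 2) ^ 3) := by
  have hq2 : 1 < q ^ 2 := one_lt_pow₀ hq two_ne_zero
  have hg := (gSeq_tendsto_and_pos hq).2
  have hg2 := (gSeq_tendsto_and_pos hq2).2
  rw [momentRatio]
  split_ifs with h
  · rw [abs_mul]
    refine mul_le_mul (abs_prod_isoRatio_le hq (by omega)) ?_ (abs_nonneg _) (by positivity)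
    have p := gSeq_pos hq2
    have l1 := gSeq_le_one hq2
    have l2 := gInf_le_gSeq hq2
    have pk := p k
    have pc := p c
    have pkm := p (k - m)
    have pcm := p (c - m)
    have pkc := p (k + c)
    have pd := p (k + c - m - m)
    rw [abs_of_pos (by positivity)]
    refine div_le_div₀ zero_le_one ?_ (by positivity) ?_
    · exact mul_le_one₀ (l1 _) (by positivity) (mul_le_one₀ (l1 _) pc.le (l1 _))
    · calc gInf (q ^ 2) ^ 3 = gInf (q ^ 2) * gInf (q ^ 2) * gInf (q ^ 2) := by ring
        _ ≤ _ := by gcongr <;> exact l2 _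
  · rw [abs_zero]
    positivity

theorem tendsto_momentRatio (hq : 1 < q) (m : ℕ) :
    Tendsto (fun p : ℕ × ℕ => momentRatio q m p.1 p.2) (atTop ×ˢ atTop) (𝓝 1) := by
  have hq2 : 1 < q ^ 2 := one_lt_pow₀ hq two_ne_zero
  obtain ⟨hg, hpos⟩ := gSeq_tendsto_and_pos hq2
  have t1 : Tendsto (fun p : ℕ × ℕ => p.1) (atTop ×ˢ atTop) atTop := tendsto_fst
  have t2 : Tendsto (fun p : ℕ × ℕ => p.2) (atTop ×ˢ atTop) atTop := tendsto_snd
  have t12 : Tendsto (fun p : ℕ × ℕ => p.1 + p.2) (atTop ×ˢ atTop) atTop :=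
    tendsto_atTop_mono (fun p => Nat.le_add_right _ _) t1
  have tm := tendsto_sub_atTop_nat m
  have hP : Tendsto (fun p : ℕ × ℕ => ∏ j ∈ Finset.range m, isoRatio q (p.1 + p.2) j)
      (atTop ×ˢ atTop) (𝓝 1) := by
    have := tendsto_finsetProd (Finset.range m) fun j _ => (tendsto_isoRatio hq j).comp t12
    simpa using this
  have hG := ((hg.comp ((tm.comp tm).comp t12)).mul ((hg.comp t1).mul (hg.comp t2))).div
    (((hg.comp (tm.comp t1)).mul (hg.comp (tm.comp t2))).mul (hg.comp t12))
    (by positivity)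
  have hone : gInf (q ^ 2) * (gInf (q ^ 2) * gInf (q ^ 2)) /
      (gInf (q ^ 2) * gInf (q ^ 2) * gInf (q ^ 2)) = 1 := by
    rw [← mul_assoc]
    exact div_self (by positivity)
  rw [hone] at hG
  have := hP.mul hG
  rw [mul_one] at this
  refine this.congr' ?_
  filter_upwards [t1.eventually_ge_atTop m, t2.eventually_ge_atTop m] with p h1 h2
  rw [momentRatio, if_pos ⟨h1, h2⟩]
  rfl

/-- The exponent `m * m` is the sum of the `2 * j + 1` for `j < m`. -/
theorem prod_isoExt (hq : 1 < q) (n m : ℕ) :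
    (∏ j ∈ Finset.range m, isoExt q n j) * q ^ (m * m) =
      q ^ (2 * n * m) * ∏ j ∈ Finset.range m, isoRatio q n j := by
  have hq0 : q ≠ 0 := by positivity
  induction m with
  | zero => simp
  | succ m ih =>
    have h : isoExt q n m * q ^ (2 * m + 1) = q ^ (2 * n) * isoRatio q n m := by
      rw [isoRatio]
      field_simp
    rw [Finset.prod_range_succ, Finset.prod_range_succ,
      show (m + 1) * (m + 1) = m * m + (2 * m + 1) by ring, mul_add_one, pow_add, pow_add]
    linear_combination isoExt q n m * q ^ (2 * m + 1) * ih +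
      q ^ (2 * n * m) * (∏ j ∈ Finset.range m, isoRatio q n j) * h

/-! ### Inverting the moments and passing to the limit -/

variable {F : Type*} [Field F] [Fintype F]

theorem binomial_moment_eq {q : ℕ} (hF : Fintype.card F = q ^ 2) (m k c : ℕ) :
    (∑ s ∈ Finset.range (k + c + 1), ((HHull hF (k + c) k s).ncard : ℝ) *
      gaussBinom ((q : ℝ) ^ 2) s m) / gaussBinom ((q : ℝ) ^ 2) (k + c) k =
      (q : ℝ) ^ m / hProd ((q : ℝ) ^ 2) m * momentRatio q m k c := by
  have hq : (1 : ℝ) < q := by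
    exact_mod_cast two_le_of_card_eq_sq hF
  have hq2 : (1 : ℝ) < (q : ℝ) ^ 2 := one_lt_pow₀ hq two_ne_zero
  rw [momentRatio]
  split_ifs with h
  · obtain ⟨a, rfl⟩ := Nat.exists_eq_add_of_le h.1
    obtain ⟨b, rfl⟩ := Nat.exists_eq_add_of_le h.2
    have hsum := sum_ncard_HHull_mul_prod (n := m + a + (m + b)) hF h.1
    have hterm (s : ℕ) : ((HHull hF (m + a + (m + b)) (m + a) s).ncard : ℝ) *
        ∏ i ∈ Finset.range m, (((q : ℝ) ^ 2) ^ s - ((q : ℝ) ^ 2) ^ i) =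
        ((HHull hF (m + a + (m + b)) (m + a) s).ncard : ℝ) * gaussBinom ((q : ℝ) ^ 2) s m *
          ∏ i ∈ Finset.range m, (((q : ℝ) ^ 2) ^ m - ((q : ℝ) ^ 2) ^ i) := by
      rw [mul_assoc, gaussBinom_mul_prod hq2]
    rw [Finset.sum_congr rfl fun s _ => hterm s, ← Finset.sum_mul, prod_pow_sub_pow_self, show m + a + (m + b) - m - m = a + b by omega,
      Nat.add_sub_cancel_left, gaussBinom_add_eq_gSeq hq2] at hsum
    rw [show m + a + (m + b) - m - m = a + b by omega, Nat.add_sub_cancel_left,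
      Nat.add_sub_cancel_left, gaussBinom_add_eq_gSeq hq2]
    have hprod := prod_isoExt hq (m + a + (m + b)) m
    generalize ∑ s ∈ Finset.range (m + a + (m + b) + 1),
      ((HHull hF (m + a + (m + b)) (m + a) s).ncard : ℝ) * gaussBinom ((q : ℝ) ^ 2) s m = S
      at hsum ⊢
    generalize ∏ j ∈ Finset.range m, isoExt (q : ℝ) (m + a + (m + b)) j = P at hsum hprod
    generalize ∏ j ∈ Finset.range m, isoRatio (q : ℝ) (m + a + (m + b)) j = R at hprod ⊢
    have g1 := gSeq_pos hq2 a
    have g2 := gSeq_pos hq2 b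
    have g3 := gSeq_pos hq2 (m + a)
    have g4 := gSeq_pos hq2 (m + b)
    have g5 := gSeq_pos hq2 (m + a + (m + b))
    have g6 := gSeq_pos hq2 (a + b)
    have g7 := hProd_pos hq2 m
    generalize gSeq ((q : ℝ) ^ 2) a = A at *
    generalize gSeq ((q : ℝ) ^ 2) b = B at *
    generalize gSeq ((q : ℝ) ^ 2) (m + a) = C at *
    generalize gSeq ((q : ℝ) ^ 2) (m + b) = D at *
    generalize gSeq ((q : ℝ) ^ 2) (m + a + (m + b)) = E at *
    generalize gSeq ((q : ℝ) ^ 2) (a + b) = G at *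
    generalize hProd ((q : ℝ) ^ 2) m = H at *
    -- All powers of `q` are compared here, with `k = m + a` and `c = m + b`; the surplus is exactly
    -- `q ^ m`.
    have hexp : (q : ℝ) ^ (2 * (m + a + (m + b)) * m) * ((q : ℝ) ^ 2) ^ (a * b) =
        (q : ℝ) ^ m * (q : ℝ) ^ (m * m) * ((q : ℝ) ^ 2) ^ ((m + a) * (m + b)) *
          ((q : ℝ) ^ 2) ^ m.choose 2 := by
      rw [← pow_mul, ← pow_mul, ← pow_mul, ← pow_add, ← pow_add, ← pow_add, ← pow_add]
      congr 1
      have := choose_two_mul_two_add m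
      nlinarith
    have hu : (q : ℝ) ^ (m * m) ≠ 0 := by positivity
    have hv : ((q : ℝ) ^ 2) ^ m.choose 2 ≠ 0 := by positivity
    have hw : ((q : ℝ) ^ 2) ^ ((m + a) * (m + b)) ≠ 0 := by positivity
    generalize (q : ℝ) ^ (2 * (m + a + (m + b)) * m) = X1 at *
    generalize ((q : ℝ) ^ 2) ^ (a * b) = X2 at *
    generalize (q : ℝ) ^ m = X3 at *
    generalize (q : ℝ) ^ (m * m) = X4 at *
    generalize ((q : ℝ) ^ 2) ^ ((m + a) * (m + b)) = X5 at *
    generalize ((q : ℝ) ^ 2) ^ m.choose 2 = X6 at *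
    have hS : S = P * (X2 * (G / (A * B))) / (X6 * H) := by
      rw [eq_div_iff (by positivity), hsum]
    have hP : P = X1 * R / X4 := by
      rw [eq_div_iff hu, hprod]
    rw [hS, hP]
    field_simp
    linear_combination R * hexp
  -- A hull has dimension at most `min k c`, so the moments beyond that vanish, matching the value 0
  -- in `momentRatio`.
  · rw [mul_zero, Finset.sum_eq_zero, zero_div]
    intro s _
    rcases lt_or_ge s m with hs | hs
    · rw [gaussBinom_eq_zero hs, mul_zero]
    · rw [ncard_HHull_eq_zero_of_lt hF (by omega), Nat.cast_zero, zero_mul]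

/-- The factor `h_{l+j}` cancels, and `h_j = x^{j(j+1)/2} g_j` with `x = q^2` absorbs the quadratic
power up to `x^{-j}`. With `q^j` this leaves the geometric term `q^{-j}`. -/
theorem gauss_weight_eq (hq : 1 < q) (l j : ℕ) :
    (-1) ^ j * (q ^ 2) ^ j.choose 2 * gaussBinom (q ^ 2) (l + j) l *
      (q ^ (l + j) / hProd (q ^ 2) (l + j)) =
      q ^ l / hProd (q ^ 2) l * ((-1 / q) ^ j / gSeq (q ^ 2) j) := by
  have hq2 : 1 < q ^ 2 := one_lt_pow₀ hq two_ne_zero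
  have e := gaussBinom_add hq2 j l
  have h1 := (hProd_pos hq2 l).ne'
  have h2 := (hProd_pos hq2 (l + j)).ne'
  have h3 := (gSeq_pos hq2 j).ne'
  have hq0 : q ≠ 0 := by positivity
  rw [add_comm j l] at e
  rw [e, hProd_eq_mul_gSeq hq2 j, choose_succ_two, pow_add (q ^ 2) j, div_pow, pow_add q l j]
  field_simp
  ring

/-- The inversion formula is a finite sum whose range grows with `k + c`; as `momentRatio` vanishes
past it, an infinite series with fixed index set replaces it, ready for dominated convergence. -/
theorem ncard_HHull_div_eq_tsum {q : ℕ} (hF : Fintype.card F = q ^ 2) {l k c : ℕ} (hl : l ≤ k) :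
    ((HHull hF (k + c) k l).ncard : ℝ) / gaussBinom ((q : ℝ) ^ 2) (k + c) k =
      ∑' j : ℕ, (q : ℝ) ^ l / hProd ((q : ℝ) ^ 2) l *
        ((-1 / (q : ℝ)) ^ j / gSeq ((q : ℝ) ^ 2) j) * momentRatio q (l + j) k c := by
  have hq : (1 : ℝ) < q := by
    exact_mod_cast two_le_of_card_eq_sq hF
  have hq2 : (1 : ℝ) < (q : ℝ) ^ 2 := one_lt_pow₀ hq two_ne_zero
  rw [tsum_eq_sum (s := Finset.range (k + c + 1)),
    eq_sum_alternating_binomial_transform hq2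
      (fun s => ((HHull hF (k + c) k s).ncard : ℝ)) (show l ≤ k + c by omega), Finset.sum_div]
  · refine Finset.sum_congr rfl fun j _ => ?_
    rw [mul_div_assoc, binomial_moment_eq, ← mul_assoc, gauss_weight_eq hq]
  · intro j hj
    rw [Finset.mem_range] at hj
    rw [momentRatio, if_neg (by omega), mul_zero]

theorem tendsto_ncard_HHull {q : ℕ} (hF : Fintype.card F = q ^ 2) (l : ℕ) :
    Tendsto (fun p : ℕ × ℕ => ((HHull hF (p.1 + p.2) p.1 l).ncard : ℝ) /
      gaussBinom ((q : ℝ) ^ 2) (p.1 + p.2) p.1) (atTop ×ˢ atTop)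
      (𝓝 ((q : ℝ) ^ l * gInf (q : ℝ) * gInf ((q : ℝ) ^ 4) /
          (hProd ((q : ℝ) ^ 2) l * gInf ((q : ℝ) ^ 2) * gInf ((q : ℝ) ^ 2)))) := by
  have hq : (1 : ℝ) < q := by
    exact_mod_cast two_le_of_card_eq_sq hF
  have hq2 : (1 : ℝ) < (q : ℝ) ^ 2 := one_lt_pow₀ hq two_ne_zero
  have hz : |-1 / (q : ℝ)| < 1 := by
    rw [neg_div, abs_neg, abs_of_pos (by positivity), div_lt_one (by positivity)]
    exact hq
  set K := (q : ℝ) ^ l / hProd ((q : ℝ) ^ 2) l with hK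
  set B := 1 / gInf (q : ℝ) * (1 / gInf ((q : ℝ) ^ 2) ^ 3)
  have hKpos : 0 < K := div_pos (by positivity) (hProd_pos hq2 l)
  have hlim : Tendsto (fun p : ℕ × ℕ => ∑' j : ℕ, K *
      ((-1 / (q : ℝ)) ^ j / gSeq ((q : ℝ) ^ 2) j) * momentRatio q (l + j) p.1 p.2)
      (atTop ×ˢ atTop) (𝓝 (∑' j : ℕ, K * ((-1 / (q : ℝ)) ^ j / gSeq ((q : ℝ) ^ 2) j))) := by
    refine tendsto_tsum_of_dominated_convergence
      (bound := fun j => K * (|-1 / (q : ℝ)| ^ j / gInf ((q : ℝ) ^ 2)) * B)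
      (((summable_abs_pow_div_gInf hz _).mul_left K).mul_right B) (fun j => ?_)
      (Eventually.of_forall fun p j => ?_)
    · simpa using (tendsto_momentRatio hq (l + j)).const_mul
        (K * ((-1 / (q : ℝ)) ^ j / gSeq ((q : ℝ) ^ 2) j))
    · rw [Real.norm_eq_abs, abs_mul, abs_mul, abs_of_pos hKpos]
      have h0 := (abs_nonneg _).trans (abs_pow_div_gSeq_le hq2 (-1 / (q : ℝ)) j)
      exact mul_le_mul (mul_le_mul_of_nonneg_left (abs_pow_div_gSeq_le hq2 _ j) hKpos.le)
        (abs_momentRatio_le hq _ _ _) (abs_nonneg _) (mul_nonneg hKpos.le h0)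
  rw [tsum_mul_left, tsum_neg_inv_pow_div_gSeq hq, hK, div_mul_div_comm, ← mul_assoc,
    ← mul_assoc] at hlim
  refine hlim.congr' ?_
  filter_upwards [tendsto_fst.eventually_ge_atTop l] with p hp
  rw [ncard_HHull_div_eq_tsum hF hp]

end Limit

theorem theorem3p8 {F : Type*} [Field F] [Fintype F] (q : ℕ) (hF : Fintype.card F = q ^ 2) :
    (∀ l : ℕ,
      Tendsto
        (fun p : ℕ × ℕ => ((HHull hF p.1 p.2 l).ncard : ℝ) / gaussBinom ((q : ℝ) ^ 2) p.1 p.2)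
        codeLimit
        (𝓝 ((q : ℝ) ^ l * gInf (q : ℝ) * gInf ((q : ℝ) ^ 4) /
          (hProd ((q : ℝ) ^ 2) l * gInf ((q : ℝ) ^ 2) * gInf ((q : ℝ) ^ 2))))) ∧
    Tendsto
      (fun p : ℕ × ℕ => ((HHull hF p.1 p.2 0).ncard : ℝ) / gaussBinom ((q : ℝ) ^ 2) p.1 p.2)
      codeLimit
      (𝓝 (gInf (q : ℝ) * gInf ((q : ℝ) ^ 4) /
        (gInf ((q : ℝ) ^ 2) * gInf ((q : ℝ) ^ 2)))) := by
  have h (l : ℕ) := tendsto_codeLimit (f := fun p : ℕ × ℕ =>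
    ((HHull hF p.1 p.2 l).ncard : ℝ) / gaussBinom ((q : ℝ) ^ 2) p.1 p.2) (tendsto_ncard_HHull hF l)
  refine ⟨h, ?_⟩
  simpa using h 0
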